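/- **Notation.** Let $m\ge 1$. Let $C=(c_{ik})\in\mathbb Z^{n\times m}$ ($n$ arbitrary) be an integer matrix with rows $C_1,\dots,C_n$, all non-zero, which is *regular* (every column sums to $0$) and of full rank $m$; no condition is imposed on the greatest common divisor $g_C$ of the maximal minors of $C$. Put $l_i(u)=\langle C_i,u\rangle$ for $u\in\mathbb C^m$. The *Horn–Kapranov parametrization* of $C$ is the rational map $$\psi_C:\mathbb P^{m-1}\dashrightarrow\mathbb C^m,\qquad \psi_C(u)_k=\prod_{i=1}^n l_i(u)^{c_{ik}}\quad(k=1,\dots,m),$$ which is well defined because its coordinates are homogeneous of degree $0$. Let $S_C\subset\mathbb C^m$ be the Zariski closure of its image. The matrix $C$ is *defective* if $\operatorname{codim}(S_C)>1$, and non-defective otherwise. For $\lambda\in(\mathbb C^*)^m$, $\lambda\cdot$ denotes coordinatewise multiplication by $\lambda$. For an irreducible hypersurface $S=\{\Delta=0\}\subset\mathbb C^m$, $\Delta$ an irreducible polynomial, the *logarithmic Gauss map* is $$\gamma_S:S\dashrightarrow\mathbb P^{m-1},\qquad \gamma_S(y)=\Bigl(y_1\tfrac{\partial\Delta}{\partial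 y_1}(y):\dots:y_m\tfrac{\partial\Delta}{\partial y_m}(y)\Bigr)$$ (if $S$ is a coordinate hyperplane, these coordinates vanish identically on $S$, and $\gamma_S$ is then not birational, by convention). **Theorem.** Let $S\subset\mathbb C^m$ be an irreducible algebraic hypersurface. 1. The logarithmic Gauss map $\gamma_S:S\dashrightarrow\mathbb P^{m-1}$ is birational if and only if there exist an $n$, a non-defective, regular integer matrix $C\in\mathbb Z^{n\times m}$ of full rank $m$ without zero rows, and a $\lambda\in(\mathbb C^*)^m$ such that $S=\lambda\cdot S_C$. 2. Moreover, for all such $C$ and $\lambda$ with $S=\lambda\cdot S_C$, the rational map $\lambda\cdot\psi_C:\mathbb P^{m-1}\dashrightarrow S$ is birational, and $\gamma_S$ is its inverse. 3. In particular, for every non-defective, regular integer matrix $C$ of full rank $m$ without zero rows, $\psi_C:\mathbb P^{m-1}\dashrightarrow S_C$ has degree $1$, that is, a generic point of $S_C$ has exactly one preimage in $\mathbb P^{m-1}$. -/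

import Mathlib

open scoped LinearAlgebra.Projectivization

noncomputable section

namespace HornKapranov

/-! ### Zariski topology on affine space -/

/-- The Zariski closure in `ℂ^m` of a set `V`. -/
def zariskiClosure {m : ℕ} (V : Set (Fin m → ℂ)) : Set (Fin m → ℂ) :=
  MvPolynomial.zeroLocus ℂ (MvPolynomial.vanishingIdeal ℂ V)

/-- The codimension in `ℂ^m` of (the Zariski closure of) `V`: the height of its vanishing ideal. -/
def codim {m : ℕ} (V : Set (Fin m → ℂ)) : ℕ∞ :=
  (MvPolynomial.vanishingIdeal ℂ V).height

/-- `Δ` is a minimal equation of the irreducible hypersurface `S ⊆ ℂ^m`: `Δ` is an irreducible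
polynomial and `S` is its zero set. -/
structure IsMinimalEquation {m : ℕ} (Δ : MvPolynomial (Fin m) ℂ) (S : Set (Fin m → ℂ)) :
    Prop where
  irreducible : Irreducible Δ
  zeroSet : S = {y | MvPolynomial.eval y Δ = 0}

/-- `p` holds at the generic point of `V`: it holds on a nonempty (relatively) Zariski open subset
of `V`. As principal open sets are a basis, the open subset may be taken principal. -/
def GenericallyOn {m : ℕ} (V : Set (Fin m → ℂ)) (p : (Fin m → ℂ) → Prop) : Prop :=
  ∃ P : MvPolynomial (Fin m) ℂ, (∃ y ∈ V, MvPolynomial.eval y P ≠ 0) ∧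
    ∀ y ∈ V, MvPolynomial.eval y P ≠ 0 → p y

/-- `p` holds at the generic point of the projective space of lines in `ℂ^k`: it holds on a
nonempty Zariski open subset, which may be taken to be the complement of the zero set of a
homogeneous polynomial. -/
def GenericallyOnProj {k : ℕ} (p : ℙ ℂ (Fin k → ℂ) → Prop) : Prop :=
  ∃ (d : ℕ) (P : MvPolynomial (Fin k) ℂ), P.IsHomogeneous d ∧
    (∃ u : ℙ ℂ (Fin k → ℂ), MvPolynomial.eval u.rep P ≠ 0) ∧
    ∀ u : ℙ ℂ (Fin k → ℂ), MvPolynomial.eval u.rep P ≠ 0 → p u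

/-! ### Rational maps between an affine variety and a projective space -/

/-- Polynomial homogeneous coordinates `y ↦ (g_1(y) : ⋯ : g_k(y))` of a rational map from a
subvariety of `ℂ^m` to `ℙ^{k-1}`. They define a rational map on an irreducible closed set `V`
when they do not all vanish identically on `V`. -/
structure AffToProj (m k : ℕ) where
  coord : Fin k → MvPolynomial (Fin m) ℂ

/-- The vector `(g_1(y), …, g_k(y))`. -/
def AffToProj.vec {m k : ℕ} (γ : AffToProj m k) (y : Fin m → ℂ) : Fin k → ℂ :=
  fun i => MvPolynomial.eval y (γ.coord i)

/-- The point `(g_1(y) : ⋯ : g_k(y))` of projective space. -/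
def AffToProj.value {m k : ℕ} (γ : AffToProj m k) (y : Fin m → ℂ) (hy : γ.vec y ≠ 0) :
    ℙ ℂ (Fin k → ℂ) :=
  Projectivization.mk ℂ (γ.vec y) hy

/-- A rational map `u ↦ (f_1(u) / f_0(u), …, f_m(u) / f_0(u))` from `ℙ^{k-1}` to `ℂ^m`, where
`f_0 ≠ 0, f_1, …, f_m` are homogeneous polynomials of the same degree. -/
structure ProjToAff (k m : ℕ) where
  deg : ℕ
  den : MvPolynomial (Fin k) ℂ
  num : Fin m → MvPolynomial (Fin k) ℂ
  den_ne_zero : den ≠ 0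
  den_homogeneous : den.IsHomogeneous deg
  num_homogeneous : ∀ j, (num j).IsHomogeneous deg

/-- The denominator does not vanish at `u`. -/
def ProjToAff.DefinedAt {k m : ℕ} (φ : ProjToAff k m) (u : ℙ ℂ (Fin k → ℂ)) : Prop :=
  MvPolynomial.eval u.rep φ.den ≠ 0

/-- The value at `u`, computed with an arbitrary representative (see `ProjToAff.value_mk`). -/
def ProjToAff.value {k m : ℕ} (φ : ProjToAff k m) (u : ℙ ℂ (Fin k → ℂ)) : Fin m → ℂ :=
  fun j => MvPolynomial.eval u.rep (φ.num j) / MvPolynomial.eval u.rep φ.den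

theorem eval_smul_of_isHomogeneous {k d : ℕ} {P : MvPolynomial (Fin k) ℂ}
    (hP : P.IsHomogeneous d) (a : ℂ) (v : Fin k → ℂ) :
    MvPolynomial.eval (a • v) P = a ^ d * MvPolynomial.eval v P := by
  rw [MvPolynomial.eval_eq, MvPolynomial.eval_eq, Finset.mul_sum]
  refine Finset.sum_congr rfl fun s hs => ?_
  have hd : ∑ i ∈ s.support, s i = d := (hP.degree_eq_sum_deg_support hs).symm
  simp only [Pi.smul_apply, smul_eq_mul, mul_pow, Finset.prod_mul_distrib,
    Finset.prod_pow_eq_pow_sum, hd]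
  ring

/-- The value does not depend on the representative. -/
theorem ProjToAff.value_mk {k m : ℕ} (φ : ProjToAff k m) (v : Fin k → ℂ) (hv : v ≠ 0) :
    φ.value (Projectivization.mk ℂ v hv) =
      fun j => MvPolynomial.eval v (φ.num j) / MvPolynomial.eval v φ.den := by
  obtain ⟨a, ha⟩ := Projectivization.exists_smul_eq_mk_rep ℂ v hv
  funext j
  have ha0 : ((a : ℂ) ^ φ.deg) ≠ 0 := pow_ne_zero _ a.ne_zero
  simp only [ProjToAff.value]
  rw [← ha, Units.smul_def, eval_smul_of_isHomogeneous (φ.num_homogeneous j),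
    eval_smul_of_isHomogeneous φ.den_homogeneous, mul_div_mul_left _ _ ha0]

/-- Definedness does not depend on the representative. -/
theorem ProjToAff.definedAt_mk {k m : ℕ} (φ : ProjToAff k m) (v : Fin k → ℂ) (hv : v ≠ 0) :
    φ.DefinedAt (Projectivization.mk ℂ v hv) ↔ MvPolynomial.eval v φ.den ≠ 0 := by
  obtain ⟨a, ha⟩ := Projectivization.exists_smul_eq_mk_rep ℂ v hv
  have ha0 : ((a : ℂ) ^ φ.deg) ≠ 0 := pow_ne_zero _ a.ne_zero
  simp only [ProjToAff.DefinedAt]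
  rw [← ha, Units.smul_def, eval_smul_of_isHomogeneous φ.den_homogeneous]
  simp [ha0]

/-- The torus translate `τ · φ`. -/
def ProjToAff.translate {k m : ℕ} (τ : Fin m → ℂˣ) (φ : ProjToAff k m) : ProjToAff k m where
  deg := φ.deg
  den := φ.den
  num j := MvPolynomial.C (τ j : ℂ) * φ.num j
  den_ne_zero := φ.den_ne_zero
  den_homogeneous := φ.den_homogeneous
  num_homogeneous j := by
    simpa using (MvPolynomial.isHomogeneous_C (Fin k) (τ j : ℂ)).mul (φ.num_homogeneous j)

/-- `γ : S ⇢ ℙ^{k-1}` and `φ : ℙ^{k-1} ⇢ S` are mutually inverse rational maps: `φ` generically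
takes its values in `S`, and both composites are generically defined and equal to the identity. -/
def MutuallyInverse {m k : ℕ} (S : Set (Fin m → ℂ)) (γ : AffToProj m k) (φ : ProjToAff k m) :
    Prop :=
  (GenericallyOn S fun y => ∃ hy : γ.vec y ≠ 0,
    φ.DefinedAt (γ.value y hy) ∧ φ.value (γ.value y hy) = y) ∧
  (GenericallyOnProj fun u => φ.DefinedAt u ∧ φ.value u ∈ S ∧
    ∃ hu : γ.vec (φ.value u) ≠ 0, γ.value (φ.value u) hu = u)

/-- The rational map `γ : S ⇢ ℙ^{k-1}` is birational: it has an inverse rational map. -/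
def AffToProj.IsBirationalOn {m k : ℕ} (S : Set (Fin m → ℂ)) (γ : AffToProj m k) : Prop :=
  ∃ φ : ProjToAff k m, MutuallyInverse S γ φ

/-- The rational map `φ : ℙ^{k-1} ⇢ S` is birational: it has an inverse rational map. -/
def ProjToAff.IsBirationalOnto {m k : ℕ} (S : Set (Fin m → ℂ)) (φ : ProjToAff k m) : Prop :=
  ∃ γ : AffToProj m k, MutuallyInverse S γ φ

/-- As a map to its closed image, `φ` has degree `d`: a generic point of the closed image has
exactly `d` preimages. -/
def ProjToAff.HasDegree {m k : ℕ} (φ : ProjToAff k m) (d : ℕ) : Prop :=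
  GenericallyOn (zariskiClosure {y | ∃ u, φ.DefinedAt u ∧ φ.value u = y}) fun y =>
    {u | φ.DefinedAt u ∧ φ.value u = y}.encard = d

/-! ### The logarithmic Gauss map -/

/-- The logarithmic Gauss map `y ↦ (y_1 ∂Δ/∂y_1 (y) : ⋯ : y_m ∂Δ/∂y_m (y))` of the hypersurface
with minimal equation `Δ`. -/
def logGauss {m : ℕ} (Δ : MvPolynomial (Fin m) ℂ) : AffToProj m m where
  coord i := MvPolynomial.X i * MvPolynomial.pderiv i Δ

/-- The tangent space at `y` of the closed set `S`. -/
def tangentSpace {m : ℕ} (S : Set (Fin m → ℂ)) (y : Fin m → ℂ) : Set (Fin m → ℂ) :=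
  {v | ∀ P ∈ MvPolynomial.vanishingIdeal ℂ S,
    ∑ i, MvPolynomial.eval y (MvPolynomial.pderiv i P) * v i = 0}

/-- The logarithmic Gauss map is the left Gauss map of the torus: its vector at `y` is an equation
of the translate to the identity, `y⁻¹ · T_y S`, of the tangent space of `S` at `y`. -/
theorem logGauss_vec_eq_zero_iff {m : ℕ} {Δ : MvPolynomial (Fin m) ℂ} {S : Set (Fin m → ℂ)}
    (h : IsMinimalEquation Δ S) {y : Fin m → ℂ} (hy : y ∈ S) (w : Fin m → ℂ) :
    ∑ i, (logGauss Δ).vec y i * w i = 0 ↔ (fun i => y i * w i) ∈ tangentSpace S y := by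
  have hv : ∀ i, (logGauss Δ).vec y i * w i =
      MvPolynomial.eval y (MvPolynomial.pderiv i Δ) * (y i * w i) := by
    intro i
    simp [AffToProj.vec, logGauss]
    ring
  simp only [hv]
  have hS : S = MvPolynomial.zeroLocus ℂ (Ideal.span {Δ}) := by
    rw [h.zeroSet, MvPolynomial.zeroLocus_span]
    ext x
    simp [MvPolynomial.aeval_eq_eval]
  constructor
  · intro hw P hP
    rw [hS, MvPolynomial.vanishingIdeal_zeroLocus_eq_radical,
      ((Ideal.span_singleton_prime h.irreducible.ne_zero).2 h.irreducible.prime).radical,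
      Ideal.mem_span_singleton] at hP
    obtain ⟨Q, rfl⟩ := hP
    have hy0 : MvPolynomial.eval y Δ = 0 := by
      rw [h.zeroSet] at hy
      exact hy
    have key : ∀ i, MvPolynomial.eval y (MvPolynomial.pderiv i (Δ * Q)) * (y i * w i) =
        MvPolynomial.eval y Q *
          (MvPolynomial.eval y (MvPolynomial.pderiv i Δ) * (y i * w i)) := by
      intro i
      simp [Derivation.leibniz, hy0]
      ring
    simp only [key]
    rw [← Finset.mul_sum, hw, mul_zero]
  · intro hw
    refine hw Δ fun x hx => ?_
    rw [h.zeroSet] at hx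
    simpa [MvPolynomial.aeval_eq_eval] using hx

/-! ### Horn–Kapranov parametrizations -/

/-- The linear form `l_i(u) = ⟨C_i, u⟩` given by the `i`-th row of `C`. -/
def linForm {n m : ℕ} (C : Matrix (Fin n) (Fin m) ℤ) (i : Fin n) (u : Fin m → ℂ) : ℂ :=
  ∑ k, (C i k : ℂ) * u k

/-- `ψ_C(u)_k = ∏ i, l_i(u) ^ c_{ik}`. -/
def psi {n m : ℕ} (C : Matrix (Fin n) (Fin m) ℤ) (u : Fin m → ℂ) : Fin m → ℂ :=
  fun k => ∏ i, linForm C i u ^ C i k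

/-- The set of points `u` where no linear form occurring with a negative exponent in some
coordinate of `ψ_C` vanishes. -/
def psiDomain {n m : ℕ} (C : Matrix (Fin n) (Fin m) ℤ) : Set (Fin m → ℂ) :=
  {u | ∀ i k, C i k < 0 → linForm C i u ≠ 0}

/-- `S_C ⊆ ℂ^m`: the Zariski closure of the image of `ψ_C`. -/
def SC {n m : ℕ} (C : Matrix (Fin n) (Fin m) ℤ) : Set (Fin m → ℂ) :=
  zariskiClosure (psi C '' psiDomain C)

/-- `C` is defective when `S_C` has codimension greater than one. -/
def Defective {n m : ℕ} (C : Matrix (Fin n) (Fin m) ℤ) : Prop :=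
  1 < codim (SC C)

/-- The matrices defining Horn–Kapranov parametrizations: integer matrices which are regular (each
column sums up to zero), have no zero row, and have full rank `m`. -/
structure IsHornMatrix {n m : ℕ} (C : Matrix (Fin n) (Fin m) ℤ) : Prop where
  regular : ∀ k, ∑ i, C i k = 0
  row_ne_zero : ∀ i, C i ≠ 0
  full_rank : (C.map (Int.cast : ℤ → ℚ)).rank = m

/-- The linear form `l_i` as a polynomial. -/
def linPoly {n m : ℕ} (C : Matrix (Fin n) (Fin m) ℤ) (i : Fin n) : MvPolynomial (Fin m) ℂ :=
  ∑ k, MvPolynomial.C (C i k : ℂ) * MvPolynomial.X k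

/-- The exponent `- min {0, c_{ik} : k}` of `l_i` in the least common denominator `f_0`. -/
def denExp {n m : ℕ} (C : Matrix (Fin n) (Fin m) ℤ) (i : Fin n) : ℕ :=
  Finset.univ.sup fun k => (-(C i k)).toNat

theorem neg_le_denExp {n m : ℕ} (C : Matrix (Fin n) (Fin m) ℤ) (i : Fin n) (k : Fin m) :
    0 ≤ C i k + denExp C i := by
  have h : (-(C i k)).toNat ≤ denExp C i :=
    Finset.le_sup (f := fun k => (-(C i k)).toNat) (Finset.mem_univ k)
  omega

theorem linPoly_ne_zero {n m : ℕ} {C : Matrix (Fin n) (Fin m) ℤ} {i : Fin n} (h : C i ≠ 0) :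
    linPoly C i ≠ 0 := by
  classical
  intro h0
  apply h
  funext k
  have h1 := congrArg (MvPolynomial.eval (Pi.single k (1 : ℂ))) h0
  simpa [linPoly, Pi.single_apply] using h1

theorem linPoly_isHomogeneous {n m : ℕ} (C : Matrix (Fin n) (Fin m) ℤ) (i : Fin n) :
    (linPoly C i).IsHomogeneous 1 :=
  MvPolynomial.IsHomogeneous.sum _ _ _ fun k _ => MvPolynomial.isHomogeneous_C_mul_X _ k

/-- `ψ_C` as a rational map on `ℙ^{m-1}`, written as `(f_1 / f_0, …, f_m / f_0)` with the least
common denominator `f_0 = ∏ i, l_i ^ (- min {0, c_{ik} : k})`. -/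
def hornKapranov {n m : ℕ} (C : Matrix (Fin n) (Fin m) ℤ) (hC : IsHornMatrix C) :
    ProjToAff m m where
  deg := ∑ i, denExp C i
  den := ∏ i, linPoly C i ^ denExp C i
  num k := ∏ i, linPoly C i ^ (C i k + denExp C i).toNat
  den_ne_zero := Finset.prod_ne_zero_iff.2 fun i _ =>
    pow_ne_zero _ (linPoly_ne_zero (hC.row_ne_zero i))
  den_homogeneous := MvPolynomial.IsHomogeneous.prod _ _ _ fun i _ => by
    simpa using (linPoly_isHomogeneous C i).pow (denExp C i)
  num_homogeneous k := by
    have hdeg : ∑ i, denExp C i = ∑ i, (C i k + denExp C i).toNat := by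
      zify
      simp only [Int.toNat_of_nonneg (neg_le_denExp C _ k), Finset.sum_add_distrib,
        hC.regular k, zero_add]
    rw [hdeg]
    exact MvPolynomial.IsHomogeneous.prod _ _ _ fun i _ => by
      simpa using (linPoly_isHomogeneous C i).pow (C i k + denExp C i).toNat

theorem eval_linPoly {n m : ℕ} (C : Matrix (Fin n) (Fin m) ℤ) (i : Fin n) (u : Fin m → ℂ) :
    MvPolynomial.eval u (linPoly C i) = linForm C i u := by
  simp [linPoly, linForm]

/-- The domain of the rational map on projective space is the domain of `psi`. -/
theorem hornKapranov_definedAt_mk {n m : ℕ} {C : Matrix (Fin n) (Fin m) ℤ} (hC : IsHornMatrix C)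
    (u : Fin m → ℂ) (hu : u ≠ 0) :
    (hornKapranov C hC).DefinedAt (Projectivization.mk ℂ u hu) ↔ u ∈ psiDomain C := by
  rw [ProjToAff.definedAt_mk]
  simp only [hornKapranov, map_prod, map_pow, eval_linPoly, Finset.prod_ne_zero_iff,
    Finset.mem_univ, true_implies, psiDomain, Set.mem_ofPred_eq]
  refine forall_congr' fun i => ?_
  constructor
  · intro h k hk h0
    have hle := neg_le_denExp C i k
    exact h (by rw [h0]; exact zero_pow (by omega))
  · intro h
    by_cases he : denExp C i = 0
    · simp [he]
    · have hex : ∃ k, C i k < 0 := by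
        by_contra! hcon
        apply he
        have : denExp C i ≤ 0 := Finset.sup_le fun k _ => by
          have := hcon k
          omega
        omega
      obtain ⟨k, hk⟩ := hex
      exact pow_ne_zero _ (h k hk)

/-- The rational map on projective space is induced by `psi`. -/
theorem hornKapranov_value_mk {n m : ℕ} {C : Matrix (Fin n) (Fin m) ℤ} (hC : IsHornMatrix C)
    (u : Fin m → ℂ) (hu : u ≠ 0) (hd : u ∈ psiDomain C) :
    (hornKapranov C hC).value (Projectivization.mk ℂ u hu) = psi C u := by
  rw [ProjToAff.value_mk]
  have hden := (hornKapranov_definedAt_mk hC u hu).2 hd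
  rw [ProjToAff.definedAt_mk] at hden
  funext k
  rw [div_eq_iff hden]
  simp only [hornKapranov, map_prod, map_pow, eval_linPoly, psi]
  rw [← Finset.prod_mul_distrib]
  refine Finset.prod_congr rfl fun i _ => ?_
  have hle := neg_le_denExp C i k
  by_cases h0 : linForm C i u = 0
  · have he : denExp C i = 0 := by
      by_contra he
      apply hden
      simp only [hornKapranov, map_prod, map_pow, eval_linPoly]
      exact Finset.prod_eq_zero (Finset.mem_univ i) (by rw [h0]; exact zero_pow he)
    rw [he] at hle ⊢
    have hc : 0 ≤ C i k := by simpa using hle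
    rw [← zpow_natCast]
    simp [Int.toNat_of_nonneg hc]
  · rw [← zpow_natCast, ← zpow_natCast, ← zpow_add₀ h0, Int.toNat_of_nonneg hle]

/-- The torus translate `τ · V`. -/
def torusTranslate {m : ℕ} (τ : Fin m → ℂˣ) (V : Set (Fin m → ℂ)) : Set (Fin m → ℂ) :=
  (fun y k => (τ k : ℂ) * y k) '' V

end HornKapranov

end

/-!
Let `g` be the value at the generic point `u` of a rational map `φ` from `ℙ^{m-1}` to the
hypersurface `Δ = 0`, with coordinates in `K = ℂ(u)`. Then `γ ∘ φ = id` if and only if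
`∑ u_k dg_k / g_k = 0` in `Ω[K⁄ℂ]`: differentiating `Δ(g) = 0` gives such a relation with
coefficients `g_k (∂_k Δ)(g)`, and the relation is unique up to a factor, as the `g_k` with a
suitable one left out are algebraically independent.

For `ψ_C` the left-hand side is `d(∑ l_i)`, which vanishes by regularity. Conversely, factor
`g_k = t_k ∏ h ^ c_{hk}` into primes of `ℂ[u]`, so that the relation reads `∑ l_h dh / h = 0` with
`l_h = ⟨c_h, u⟩`. Its residue along `h = 0` shows that `h` divides `l_h ∂_j h` for all `j`, hence
divides `l_h`, hence is a scalar multiple of `l_h`. The relation is then `d(∑ l_h) = 0`, which is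
regularity. The rank becomes full by adding the rows `± e_j`, which only changes the sign of `ψ`;
the sign is absorbed in `λ`.
-/

noncomputable section

namespace HornKapranov

open MvPolynomial KaehlerDifferential

/-! ### Differentials in characteristic zero -/

theorem mapBaseChange_injective_of_formallySmooth (k A K : Type*) [CommRing k] [CommRing A]
    [CommRing K] [Algebra k A] [Algebra k K] [Algebra A K] [IsScalarTower k A K]
    [Algebra.FormallySmooth A K] : Function.Injective (mapBaseChange k A K) := by
  rw [injective_iff_map_eq_zero]
  intro x hx
  obtain ⟨y, rfl⟩ := (Algebra.H1Cotangent.exact_δ_mapBaseChange k A K x).1 hx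
  rw [Subsingleton.elim y 0, map_zero]

theorem formallySmooth_of_charZero (F K : Type*) [Field F] [Field K] [CharZero F] [Algebra F K] :
    Algebra.FormallySmooth F K := by
  obtain ⟨s, hs⟩ := exists_isTranscendenceBasis F K
  have := hs.isAlgebraic_field
  exact .of_algebraicIndependent_of_isSeparable hs.1

section Differentials

variable {ι k K : Type*} [Field k] [CharZero k] [Field K] [Algebra k K] {x : ι → K}

theorem linearIndependent_D_of_algebraicIndependent (hx : AlgebraicIndependent k x) :
    LinearIndependent K fun i => D k K (x i) := by
  let : Algebra (MvPolynomial ι k) K := (aeval (R := k) x).toAlgebra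
  have : IsScalarTower k (MvPolynomial ι k) K := .of_algHom (aeval x)
  have : FaithfulSMul (MvPolynomial ι k) K := (faithfulSMul_iff_algebraMap_injective _ _).2 hx
  let : Algebra (FractionRing (MvPolynomial ι k)) K := FractionRing.liftAlgebra _ K
  have : Algebra.FormallySmooth (MvPolynomial ι k) K :=
    have := formallySmooth_of_charZero (FractionRing (MvPolynomial ι k)) K
    have := Algebra.FormallySmooth.of_isLocalization (Rₘ := FractionRing (MvPolynomial ι k))
      (nonZeroDivisors (MvPolynomial ι k))
    .comp _ (FractionRing (MvPolynomial ι k)) _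
  have hD (i : ι) : D k K (x i) = mapBaseChange k _ K ((mvPolynomialBasis k ι).baseChange K i) := by
    rw [Module.Basis.baseChange_apply, mvPolynomialBasis_apply, mapBaseChange_tmul, map_D, one_smul]
    exact congrArg _ (aeval_X x i).symm
  simp only [hD]
  exact ((mvPolynomialBasis k ι).baseChange K).linearIndependent.map'
    (mapBaseChange k _ K)
    (LinearMap.ker_eq_bot.2 (mapBaseChange_injective_of_formallySmooth k _ K))

end Differentials

theorem derivation_aeval {σ k A M : Type*} [Fintype σ] [CommSemiring k] [CommSemiring A]
    [Algebra k A] [AddCommMonoid M] [Module k M] [Module A M] (d : Derivation k A M) (x : σ → A)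
    (p : MvPolynomial σ k) : d (aeval x p) = ∑ i, aeval x (pderiv i p) • d (x i) := by
  classical
  induction p using MvPolynomial.induction_on with
  | C a => simp
  | add p q hp hq => simp [hp, hq, add_smul, Finset.sum_add_distrib]
  | mul_X p j hp =>
    have hX : ∑ i, aeval x (p * pderiv i (X j)) • d (x i) = aeval x p • d (x j) := by
      rw [Finset.sum_eq_single j] <;> simp +contextual [eq_comm]
    simp only [Derivation.leibniz, smul_eq_mul, map_add, add_smul, Finset.sum_add_distrib, hX]
    simp [hp, Derivation.leibniz, Finset.smul_sum, smul_smul]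

theorem mul_eq_mul_of_sum_smul_eq_zero {ι R M : Type*} [Fintype ι] [CommRing R] [AddCommGroup M]
    [Module R M] {v : ι → M} {a b : ι → R} {i₀ : ι}
    (hv : LinearIndependent R fun i : {i // i ≠ i₀} => v i) (ha : ∑ i, a i • v i = 0)
    (hb : ∑ i, b i • v i = 0) (i : ι) : a i * b i₀ = a i₀ * b i := by
  classical
  rcases eq_or_ne i i₀ with rfl | hi
  · rfl
  have hsum : ∑ i, (b i₀ * a i - a i₀ * b i) • v i = 0 := by
    simp only [sub_smul, mul_smul, Finset.sum_sub_distrib, ← Finset.smul_sum, ha, hb, smul_zero,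
      sub_zero]
  have hsum' : ∑ i : {i // i ≠ i₀}, (b i₀ * a i - a i₀ * b i) • v i = 0 := by
    rw [← hsum, ← Finset.add_sum_erase _ _ (Finset.mem_univ i₀), mul_comm, sub_self, zero_smul,
      zero_add]
    exact (Finset.sum_subtype _ (by simp) fun i => (b i₀ * a i - a i₀ * b i) • v i).symm
  linear_combination Fintype.linearIndependent_iff.1 hv _ hsum' ⟨i, hi⟩

section LogDifferential

variable (k : Type*) {ι K : Type*} [CommRing k] [Field K] [Algebra k K]

/-- The logarithmic differential `dx / x`; it is `0` at `x = 0`. -/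
def dlog (x : K) : Ω[K⁄k] := x⁻¹ • D k K x

variable {k}

theorem smul_dlog {x : K} (hx : x ≠ 0) : x • dlog k x = D k K x := smul_inv_smul₀ hx _

theorem dlog_algebraMap (a : k) : dlog k (algebraMap k K a) = 0 := by
  rw [dlog, Derivation.map_algebraMap, smul_zero]

theorem dlog_mul {x y : K} (hx : x ≠ 0) (hy : y ≠ 0) : dlog k (x * y) = dlog k x + dlog k y := by
  simp only [dlog, Derivation.leibniz, smul_add, smul_smul]
  rw [add_comm]
  congr 2 <;> field_simp

theorem dlog_prod {s : Finset ι} {x : ι → K} (hx : ∀ i ∈ s, x i ≠ 0) :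
    dlog k (∏ i ∈ s, x i) = ∑ i ∈ s, dlog k (x i) := by
  classical
  induction s using Finset.induction_on with
  | empty => simp [dlog]
  | insert i s hi ih =>
    rw [Finset.forall_mem_insert] at hx
    rw [Finset.prod_insert hi, Finset.sum_insert hi,
      dlog_mul hx.1 (Finset.prod_ne_zero_iff.2 hx.2), ih hx.2]

theorem dlog_zpow (x : K) (n : ℤ) : dlog k (x ^ n) = n • dlog k x := by
  rcases eq_or_ne x 0 with rfl | hx
  · rcases eq_or_ne n 0 with rfl | hn
    · simp [dlog]
    · simp [dlog, zero_zpow n hn]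
  · simp only [dlog, Derivation.leibniz_zpow]
    rw [smul_comm, smul_smul, zpow_sub_one₀ hx, inv_mul_cancel_left₀ (zpow_ne_zero n hx)]

end LogDifferential

/-! ### Prime factorizations and residues -/

section UniqueFactorization

variable {ι R : Type*} [Finite ι] [CommRing R] [IsDomain R] [UniqueFactorizationMonoid R]

open UniqueFactorizationMonoid in
theorem exists_simultaneous_prime_factorization (f : ι → R) (hf : ∀ i, f i ≠ 0) :
    ∃ (H : Finset R) (a : ι → Rˣ) (e : R → ι → ℕ), (∀ h ∈ H, Prime h) ∧
      (H : Set R).Pairwise IsRelPrime ∧ ∀ i, f i = a i * ∏ h ∈ H, h ^ e h i := by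
  classical
  cases nonempty_fintype ι
  let : NormalizationMonoid R := Classical.choice inferInstance
  choose a ha using fun i => prod_normalizedFactors (hf i)
  refine ⟨primeFactors (∏ i, f i), a, fun h i => (normalizedFactors (f i)).count h,
    fun h hh => prime_of_normalized_factor h (mem_primeFactors.1 hh),
    pairwise_primeFactors_isRelPrime, fun i => ?_⟩
  have hsub : (normalizedFactors (f i)).toFinset ⊆ primeFactors (∏ i, f i) := by
    rw [← toFinset_normalizedFactors, Multiset.toFinset_subset]
    exact Multiset.subset_of_le <| (dvd_iff_normalizedFactors_le_normalizedFactors (hf i)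
      (Finset.prod_ne_zero_iff.2 fun i _ => hf i)).1 (Finset.dvd_prod_of_mem f (Finset.mem_univ i))
  rw [← Finset.prod_multiset_count_of_subset _ _ hsub, mul_comm, ha i]

theorem exists_simultaneous_prime_factorization_fractions {K : Type*} [Field K] [Algebra R K]
    [IsFractionRing R K] (g : ι → K) (hg : ∀ i, g i ≠ 0) :
    ∃ (H : Finset R) (a : ι → Rˣ) (e : R → ι → ℤ), (∀ h ∈ H, Prime h) ∧
      (H : Set R).Pairwise IsRelPrime ∧ (∀ h ∈ H, e h ≠ 0) ∧
      ∀ i, g i = algebraMap R K (a i) * ∏ h ∈ H, algebraMap R K h ^ e h i := by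
  classical
  choose p q hq hpq using fun i => IsFractionRing.div_surjective (A := R) (g i)
  obtain ⟨H, a, e, hprime, hH, hfac⟩ := exists_simultaneous_prime_factorization (Sum.elim p q) <| by
    rintro (i | i)
    · rintro (hp : p i = 0)
      exact hg i (by rw [← hpq i, hp, map_zero, zero_div])
    · exact nonZeroDivisors.ne_zero (hq i)
  let E (h : R) (i : ι) : ℤ := e h (.inl i) - e h (.inr i)
  refine ⟨H.filter fun h => E h ≠ 0, fun i => a (.inl i) / a (.inr i), E,
    fun h hh => hprime h (Finset.mem_filter.1 hh).1, hH.mono (Finset.filter_subset _ _),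
    fun h hh => (Finset.mem_filter.1 hh).2, fun i => ?_⟩
  have hne (h) (hh : h ∈ H) : algebraMap R K h ≠ 0 :=
    (map_ne_zero_iff _ (IsFractionRing.injective R K)).2 (hprime h hh).ne_zero
  rw [Finset.prod_filter_of_ne fun h _ => mt fun hE => by rw [hE, Pi.zero_apply, zpow_zero],
    ← hpq i, show p i = _ from hfac (.inl i), show q i = _ from hfac (.inr i)]
  simp only [map_mul, map_prod, map_pow]
  rw [mul_div_mul_comm, ← Finset.prod_div_distrib]
  congr 1
  · rw [div_eq_iff ((a (.inr i)).isUnit.map _).ne_zero, ← map_mul, ← Units.val_mul,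
      div_mul_cancel]
  · refine Finset.prod_congr rfl fun h hh => ?_
    rw [zpow_sub₀ (hne h hh), zpow_natCast, zpow_natCast]

end UniqueFactorization

theorem dvd_of_sum_div_eq_zero {R K : Type*} [CommRing R] [DecompositionMonoid R] [Field K]
    [Algebra R K] [FaithfulSMul R K] {H : Finset R} (hne : ∀ h ∈ H, h ≠ 0)
    (hH : (H : Set R).Pairwise IsRelPrime) {p : R → R}
    (hsum : ∑ h ∈ H, algebraMap R K (p h) / algebraMap R K h = 0) {h : R} (hh : h ∈ H) :
    h ∣ p h := by
  classical
  have hsum' : ∑ h ∈ H, p h * ∏ h' ∈ H.erase h, h' = 0 := by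
    apply FaithfulSMul.algebraMap_injective R K
    rw [map_zero, map_sum, ← mul_zero (∏ h ∈ H, algebraMap R K h), ← hsum, Finset.mul_sum]
    refine Finset.sum_congr rfl fun h hh => ?_
    have hne : algebraMap R K h ≠ 0 := by simpa using hne h hh
    rw [← Finset.mul_prod_erase H _ hh, map_mul, map_prod]
    field_simp
  have hdvd : h ∣ p h * ∏ h' ∈ H.erase h, h' := by
    rw [← Finset.add_sum_erase H _ hh] at hsum'
    rw [eq_neg_of_add_eq_zero_left hsum', dvd_neg]
    refine Finset.dvd_sum fun g hg => Dvd.dvd.mul_left (Finset.dvd_prod_of_mem _ ?_) _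
    exact Finset.mem_erase.2 ⟨(Finset.ne_of_mem_erase hg).symm, hh⟩
  exact (IsRelPrime.prod_right fun g hg => hH hh (Finset.mem_of_mem_erase hg)
    (Finset.ne_of_mem_erase hg).symm).dvd_of_dvd_mul_right hdvd

/-! ### Degrees and partial derivatives -/

section Polynomials

variable {σ k : Type*}

theorem totalDegree_pderiv_lt [CommSemiring k] {p : MvPolynomial σ k}
    (hp : 0 < p.totalDegree) (i : σ) : (pderiv i p).totalDegree < p.totalDegree := by
  rw [totalDegree, Finset.sup_lt_iff hp]
  intro s hs
  rw [mem_support_iff, coeff_pderiv] at hs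
  have hle := le_totalDegree (mem_support_iff.2 (left_ne_zero_of_mul hs))
  rw [Finsupp.sum_add_index' (by simp) (by simp)] at hle
  simp only [Finsupp.sum_single_index] at hle
  omega

variable [CommRing k] [IsDomain k]

theorem eq_zero_of_dvd_of_totalDegree_lt {p q : MvPolynomial σ k} (h : p ∣ q)
    (hd : q.totalDegree < p.totalDegree) : q = 0 := by
  obtain ⟨r, rfl⟩ := h
  by_contra h0
  rw [totalDegree_mul_of_isDomain (left_ne_zero_of_mul h0) (right_ne_zero_of_mul h0)] at hd
  omega

theorem exists_pderiv_ne_zero [CharZero k] {p : MvPolynomial σ k} (hp : p.totalDegree ≠ 0) :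
    ∃ i, pderiv i p ≠ 0 := by
  contrapose! hp
  rw [totalDegree_eq_zero_iff]
  intro s hs i
  by_contra hi
  have hs' : s - Finsupp.single i 1 + Finsupp.single i 1 = s :=
    tsub_add_cancel_of_le (by simpa [Nat.one_le_iff_ne_zero] using hi)
  have hcoeff := congrArg (coeff (s - Finsupp.single i 1)) (hp i)
  rw [coeff_pderiv, hs', coeff_zero, mul_eq_zero] at hcoeff
  exact hcoeff.elim (mem_support_iff.1 hs) (by norm_cast)

end Polynomials

section Fields

variable {σ k : Type*} [Field k] {p : MvPolynomial σ k}

theorem totalDegree_pos_of_not_isUnit (h0 : p ≠ 0) (hp : ¬ IsUnit p) :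
    0 < p.totalDegree := by
  rw [pos_iff_ne_zero, Ne, totalDegree_eq_zero_iff_eq_C]
  intro hC
  rw [hC] at hp h0
  exact hp ((IsUnit.mk0 _ (C_ne_zero.1 h0)).map C)

theorem exists_pderiv_not_dvd [CharZero k] (h0 : p ≠ 0) (hp : ¬ IsUnit p) :
    ∃ i, ¬ p ∣ pderiv i p := by
  have hpos := totalDegree_pos_of_not_isUnit h0 hp
  obtain ⟨i, hi⟩ := exists_pderiv_ne_zero hpos.ne'
  exact ⟨i, fun hdvd => hi (eq_zero_of_dvd_of_totalDegree_lt hdvd (totalDegree_pderiv_lt hpos i))⟩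

theorem associated_of_dvd_of_isHomogeneous_one {q : MvPolynomial σ k} (hp : ¬ IsUnit p)
    (hq : q.IsHomogeneous 1) (hq0 : q ≠ 0) (hdvd : p ∣ q) : Associated p q := by
  have hirr : Irreducible q := by
    refine irreducible_of_totalDegree_eq_one (hq.totalDegree hq0) fun x hx => ?_
    obtain ⟨s, hs⟩ := ne_zero_iff.1 hq0
    exact (ne_zero_of_dvd_ne_zero hs (hx s)).isUnit
  exact (hirr.dvd_iff.1 hdvd).resolve_left hp |>.symm

end Fields

/-! ### Products of integral linear forms -/

section IntegralForms

variable {ι σ : Type*} [Fintype σ]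

/-- The value `∑ k, r_k u_k` at `u` of the linear form with integral coefficients `r`, as an
additive function of `r`. -/
def intForm {A : Type*} [AddCommGroup A] (u : σ → A) : (σ → ℤ) →ₗ[ℤ] A :=
  Fintype.linearCombination ℤ u

theorem intForm_apply {A : Type*} [AddCommGroup A] (u : σ → A) (r : σ → ℤ) :
    intForm u r = ∑ k, r k • u k :=
  Fintype.linearCombination_apply ℤ u r

theorem map_intForm {A B F : Type*} [AddCommGroup A] [AddCommGroup B] [FunLike F A B]
    [AddMonoidHomClass F A B] (f : F) (u : σ → A) (r : σ → ℤ) :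
    f (intForm u r) = intForm (fun k => f (u k)) r := by
  simp only [intForm_apply, map_sum, map_zsmul]

theorem isHomogeneous_intForm_X {k : Type*} [CommRing k] (r : σ → ℤ) :
    (intForm (X : σ → MvPolynomial σ k) r).IsHomogeneous 1 := by
  rw [intForm_apply]
  exact .sum _ _ _ fun j _ => (homogeneousSubmodule σ k 1).toAddSubgroup.zsmul_mem
    (isHomogeneous_X k j) (r j)

/-- The Horn–Kapranov parametrization `u ↦ (∏ i, ⟨C_i, u⟩ ^ c_{ik})_k` over an arbitrary field, for
the matrix with rows `C i`. -/
def hornProduct {F : Type*} [Fintype ι] [Field F] (C : ι → σ → ℤ) (u : σ → F) : σ → F :=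
  fun k => ∏ i, intForm u (C i) ^ C i k

variable (k : Type*) {K : Type*} [Field K]

/-- The equation `∑ k, u_k dg_k / g_k = 0` between differentials over `k`, with all `g_k ≠ 0`:
for `u` the generic point of projective space it says that `g` is a section of the logarithmic
Gauss map. -/
structure IsLogGaussSection [CommRing k] [Algebra k K] (u g : σ → K) : Prop where
  ne_zero : ∀ k, g k ≠ 0
  sum_smul_dlog : ∑ j, u j • dlog k (g j) = 0

variable {k}

theorem sum_smul_dlog_mul_prod_zpow [CommRing k] [Algebra k K] {u : σ → K} {s : Finset ι}
    {x : ι → K} (hx : ∀ i ∈ s, x i ≠ 0) (t : σ → kˣ) (e : ι → σ → ℤ) :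
    ∑ j, u j • dlog k (algebraMap k K (t j) * ∏ i ∈ s, x i ^ e i j) =
      ∑ i ∈ s, intForm u (e i) • dlog k (x i) := by
  have hpow {j : σ} : ∀ i ∈ s, x i ^ e i j ≠ 0 := fun i hi => zpow_ne_zero _ (hx i hi)
  have hdlog (j : σ) : dlog k (algebraMap k K (t j) * ∏ i ∈ s, x i ^ e i j) =
      ∑ i ∈ s, e i j • dlog k (x i) := by
    rw [dlog_mul ((t j).isUnit.map _).ne_zero (Finset.prod_ne_zero_iff.2 hpow), dlog_algebraMap,
      zero_add, dlog_prod hpow]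
    simp only [dlog_zpow]
  simp only [hdlog, Finset.smul_sum, intForm_apply, Finset.sum_smul]
  rw [Finset.sum_comm]
  exact Finset.sum_congr rfl fun i _ => Finset.sum_congr rfl fun j _ => by
    rw [smul_comm, smul_assoc]

theorem sum_smul_dlog_hornProduct [CommRing k] [Algebra k K] [Fintype ι] {C : ι → σ → ℤ}
    {u : σ → K} (hC : ∀ i, intForm u (C i) ≠ 0) (t : σ → kˣ) :
    ∑ j, u j • dlog k (algebraMap k K (t j) * hornProduct C u j) =
      D k K (intForm u (∑ i, C i)) := by
  simp only [hornProduct]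
  rw [sum_smul_dlog_mul_prod_zpow (fun i _ => hC i) t C, map_sum, map_sum]
  exact Finset.sum_congr rfl fun i _ => smul_dlog (hC i)

theorem isLogGaussSection_hornProduct [CommRing k] [Algebra k K] [Fintype ι] {C : ι → σ → ℤ}
    {u : σ → K} (hC : ∀ i, intForm u (C i) ≠ 0) (hsum : ∑ i, C i = 0) (t : σ → kˣ) :
    IsLogGaussSection k u fun j => algebraMap k K (t j) * hornProduct C u j where
  ne_zero j := mul_ne_zero ((t j).isUnit.map _).ne_zero
    (Finset.prod_ne_zero_iff.2 fun i _ => zpow_ne_zero _ (hC i))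
  sum_smul_dlog := by rw [sum_smul_dlog_hornProduct hC, hsum, map_zero, map_zero]

variable [Field k] [CharZero k] [Algebra k K] {u g : σ → K}

theorem D_intForm_eq_zero_iff (hu : AlgebraicIndependent k u) {r : σ → ℤ} :
    D k K (intForm u r) = 0 ↔ r = 0 := by
  have : CharZero K := charZero_of_injective_algebraMap (algebraMap k K).injective
  refine ⟨fun h => ?_, by rintro rfl; rw [map_zero, map_zero]⟩
  have hD := linearIndependent_D_of_algebraicIndependent hu
  rw [map_intForm, intForm_apply] at h
  simp only [← Int.cast_smul_eq_zsmul K] at h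
  exact _root_.funext fun j => Int.cast_eq_zero.1 (Fintype.linearIndependent_iff.1 hD _ h j)

theorem IsLogGaussSection.not_algebraicIndependent [Nonempty σ] (hg : IsLogGaussSection k u g)
    (hu : ∀ j, u j ≠ 0) : ¬ AlgebraicIndependent k g := by
  intro hind
  have hD := linearIndependent_D_of_algebraicIndependent hind
  have hsum := hg.sum_smul_dlog
  simp only [dlog, smul_smul] at hsum
  obtain ⟨j⟩ := ‹Nonempty σ›
  exact mul_ne_zero (hu j) (inv_ne_zero (hg.ne_zero j))
    (Fintype.linearIndependent_iff.1 hD _ hsum j)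

end IntegralForms

section GenericPoint

variable {σ : Type*} (k K : Type*) [Field k] [Field K] [Algebra (MvPolynomial σ k) K]

/-- The generic point of affine space: the family of the variables, as rational functions. -/
def genericPoint : σ → K := fun i => algebraMap (MvPolynomial σ k) K (X i)

variable {k}

theorem algebraMap_intForm_X [Fintype σ] (r : σ → ℤ) :
    algebraMap (MvPolynomial σ k) K (intForm X r) = intForm (genericPoint k K) r :=
  map_intForm _ _ _

variable {K} in
theorem genericPoint_ne_zero [IsFractionRing (MvPolynomial σ k) K] (i : σ) :
    genericPoint k K i ≠ 0 :=
  (map_ne_zero_iff _ (IsFractionRing.injective _ K)).2 (X_ne_zero i)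

variable [Algebra k K] [IsScalarTower k (MvPolynomial σ k) K]

theorem aeval_genericPoint (p : MvPolynomial σ k) :
    aeval (genericPoint k K) p = algebraMap (MvPolynomial σ k) K p := by
  rw [show genericPoint k K = algebraMap (MvPolynomial σ k) K ∘ X from rfl, aeval_algebraMap_apply,
    aeval_X_left_apply]

variable {K} in
theorem exists_units_algebraMap_eq (a : (MvPolynomial σ k)ˣ) :
    ∃ t : kˣ, algebraMap k K t = algebraMap (MvPolynomial σ k) K a := by
  obtain ⟨t, ht, ha⟩ := isUnit_iff_eq_C_of_isReduced.1 a.isUnit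
  exact ⟨ht.unit, by rw [ha, ht.unit_spec, IsScalarTower.algebraMap_apply k (MvPolynomial σ k),
    algebraMap_eq]⟩

variable [IsFractionRing (MvPolynomial σ k) K]

theorem algebraicIndependent_genericPoint : AlgebraicIndependent k (genericPoint (σ := σ) k K) := by
  rw [algebraicIndependent_iff]
  intro p hp
  rwa [aeval_genericPoint, map_eq_zero_iff _ (IsFractionRing.injective _ K)] at hp

variable {K} [CharZero k]

theorem dvd_of_sum_smul_dlog_eq_zero [Finite σ] {H : Finset (MvPolynomial σ k)}
    (hprime : ∀ h ∈ H, Prime h) (hH : (H : Set (MvPolynomial σ k)).Pairwise IsRelPrime)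
    {p : MvPolynomial σ k → MvPolynomial σ k}
    (hsum : ∑ h ∈ H, algebraMap (MvPolynomial σ k) K (p h) •
      dlog k (algebraMap (MvPolynomial σ k) K h) = 0) {h : MvPolynomial σ k} (hh : h ∈ H) :
    h ∣ p h := by
  cases nonempty_fintype σ
  have hD := linearIndependent_D_of_algebraicIndependent
    (algebraicIndependent_genericPoint (σ := σ) (k := k) K)
  have hD_algebraMap (q : MvPolynomial σ k) : D k K (algebraMap _ K q) =
      ∑ i, algebraMap _ K (pderiv i q) • D k K (genericPoint k K i) := by
    simpa only [aeval_genericPoint] using derivation_aeval (D k K) (genericPoint k K) q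
  have hcoeff (i : σ) : ∑ h ∈ H, algebraMap (MvPolynomial σ k) K (p h * pderiv i h) /
      algebraMap (MvPolynomial σ k) K h = 0 := by
    refine Fintype.linearIndependent_iff.1 hD (fun i => ∑ h ∈ H,
      algebraMap (MvPolynomial σ k) K (p h * pderiv i h) / algebraMap (MvPolynomial σ k) K h) ?_ i
    rw [← hsum]
    simp only [dlog, hD_algebraMap, Finset.smul_sum, Finset.sum_smul, smul_smul]
    rw [Finset.sum_comm]
    refine Finset.sum_congr rfl fun h _ => Finset.sum_congr rfl fun i _ => ?_
    rw [map_mul, div_eq_mul_inv, mul_right_comm, mul_assoc]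
  obtain ⟨i, hi⟩ := exists_pderiv_not_dvd (hprime h hh).ne_zero (hprime h hh).not_isUnit
  have hdvd := dvd_of_sum_div_eq_zero (fun h hh => (hprime h hh).ne_zero) hH (hcoeff i) hh
  exact ((hprime h hh).dvd_or_dvd hdvd).resolve_right hi

variable [Fintype σ]

theorem intForm_genericPoint_ne_zero {r : σ → ℤ} (hr : r ≠ 0) : intForm (genericPoint k K) r ≠ 0 :=
  fun h => hr <| (D_intForm_eq_zero_iff (algebraicIndependent_genericPoint (k := k) K)).1 <| by
    rw [h, map_zero]

theorem exists_eq_units_mul_intForm_of_dvd {h : MvPolynomial σ k} (hh : ¬ IsUnit h) {r : σ → ℤ}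
    (hr : r ≠ 0) (hdvd : h ∣ intForm X r) :
    ∃ b : kˣ, algebraMap (MvPolynomial σ k) K h =
      algebraMap k K b * intForm (genericPoint k K) r := by
  have hne : intForm (X : σ → MvPolynomial σ k) r ≠ 0 := fun h0 =>
    intForm_genericPoint_ne_zero (k := k) (K := K) hr (by rw [← algebraMap_intForm_X, h0, map_zero])
  obtain ⟨a, ha⟩ := (associated_of_dvd_of_isHomogeneous_one hh (isHomogeneous_intForm_X r) hne
    hdvd).symm
  obtain ⟨b, hb⟩ := exists_units_algebraMap_eq (K := K) a
  exact ⟨b, by rw [← ha, map_mul, algebraMap_intForm_X, hb, mul_comm]⟩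

namespace IsLogGaussSection

variable {g : σ → K}

theorem exists_eq_hornProduct (hg : IsLogGaussSection k (genericPoint k K) g) :
    ∃ (n : ℕ) (C : Fin n → σ → ℤ) (t : σ → kˣ), (∀ i, C i ≠ 0) ∧
      ∀ j, g j = algebraMap k K (t j) * hornProduct C (genericPoint k K) j := by
  obtain ⟨H, a, e, hprime, hH, he, hfac⟩ :=
    exists_simultaneous_prime_factorization_fractions (R := MvPolynomial σ k) g hg.ne_zero
  choose a' ha' using fun j => exists_units_algebraMap_eq (K := K) (a j)
  have hne : ∀ h ∈ H, algebraMap (MvPolynomial σ k) K h ≠ 0 := fun h hh =>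
    (map_ne_zero_iff _ (IsFractionRing.injective _ K)).2 (hprime h hh).ne_zero
  have hdvd : ∀ h ∈ H, h ∣ intForm X (e h) := fun h hh => by
    refine dvd_of_sum_smul_dlog_eq_zero (K := K) (p := fun h => intForm X (e h)) hprime hH ?_ hh
    have hdlog := hg.sum_smul_dlog
    simp only [hfac, ← ha'] at hdlog
    rw [sum_smul_dlog_mul_prod_zpow hne] at hdlog
    simpa only [algebraMap_intForm_X] using hdlog
  choose! b hb using fun h hh =>
    exists_eq_units_mul_intForm_of_dvd (K := K) (hprime h hh).not_isUnit (he h hh) (hdvd h hh)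
  refine ⟨H.card, fun i => e (H.equivFin.symm i), fun j => a' j * ∏ h ∈ H, b h ^ e h j,
    fun i => he _ (H.equivFin.symm i).2, fun j => ?_⟩
  have hreindex : hornProduct (fun i => e (H.equivFin.symm i)) (genericPoint k K) j =
      ∏ h ∈ H, intForm (genericPoint k K) (e h) ^ e h j :=
    (H.equivFin.symm.prod_comp fun h => intForm (genericPoint k K) (e h) ^ e h j).trans
      (Finset.prod_coe_sort H fun h => intForm (genericPoint k K) (e h) ^ e h j)
  rw [hfac, ← ha', hreindex, Finset.prod_congr rfl fun h hh => by rw [hb h hh, mul_zpow],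
    Finset.prod_mul_distrib, Units.val_mul, map_mul, mul_assoc]
  simp

theorem exists_regular_eq_hornProduct (hg : IsLogGaussSection k (genericPoint k K) g) :
    ∃ (n : ℕ) (C : Fin n → σ → ℤ) (t : σ → kˣ), (∀ i, C i ≠ 0) ∧ ∑ i, C i = 0 ∧
      ∀ j, g j = algebraMap k K (t j) * hornProduct C (genericPoint k K) j := by
  obtain ⟨n, C, t, hC, hgC⟩ := hg.exists_eq_hornProduct
  refine ⟨n, C, t, hC, ?_, hgC⟩
  rw [← D_intForm_eq_zero_iff (algebraicIndependent_genericPoint (k := k) K),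
    ← sum_smul_dlog_hornProduct (fun i => intForm_genericPoint_ne_zero (hC i)) t]
  simpa only [hgC] using hg.sum_smul_dlog

end IsLogGaussSection

end GenericPoint

/-! ### Specialization of rational functions -/

section Specialization

variable {σ τ k : Type*} [Field k]

/-- The polynomial obtained from `R (u, num / den)` by multiplication by a power of `den`. -/
def clearDenominators (den : MvPolynomial σ k) (num : τ → MvPolynomial σ k)
    (R : MvPolynomial (σ ⊕ τ) k) : MvPolynomial σ k :=
  ∑ s ∈ R.support, C (coeff s R) * (den ^ (R.totalDegree - s.sum fun _ e => e) *
    ∏ j ∈ s.support, Sum.elim (fun i => X i * den) num j ^ s j)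

theorem map_clearDenominators {F : Type*} [Field F] [Algebra k F] (f : MvPolynomial σ k →ₐ[k] F)
    {den : MvPolynomial σ k} (hden : f den ≠ 0) (num : τ → MvPolynomial σ k)
    (R : MvPolynomial (σ ⊕ τ) k) :
    f (clearDenominators den num R) = f den ^ R.totalDegree *
      aeval (Sum.elim (fun i => f (X i)) fun j => f (num j) / f den) R := by
  have hquot : (Sum.elim (fun i => f (X i)) fun j => f (num j) / f den) =
      fun j => f (Sum.elim (fun i => X i * den) num j) / f den := by
    ext (i | j)
    · simp [hden]
    · rfl
  rw [hquot, clearDenominators, map_sum, aeval_def, eval₂_eq, Finset.mul_sum]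
  refine Finset.sum_congr rfl fun s hs => ?_
  rw [← pow_sub_mul_pow _ (le_totalDegree hs), Finsupp.sum, ← algebraMap_eq]
  simp only [map_mul, map_pow, map_prod, div_pow, Finset.prod_div_distrib, AlgHom.commutes,
    Finset.prod_pow_eq_pow_sum]
  field_simp

variable {K : Type*} [Field K] [Algebra (MvPolynomial σ k) K] [Algebra k K]
  [IsScalarTower k (MvPolynomial σ k) K] [IsFractionRing (MvPolynomial σ k) K]
  {den : MvPolynomial σ k} (hden : den ≠ 0) {num : τ → MvPolynomial σ k}
  {R : MvPolynomial (σ ⊕ τ) k}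
include hden

theorem aeval_graph_eq_zero_iff_clearDenominators :
    aeval (Sum.elim (genericPoint k K) fun j => algebraMap _ K (num j) / algebraMap _ K den) R = 0 ↔
      clearDenominators den num R = 0 := by
  have hden' : algebraMap (MvPolynomial σ k) K den ≠ 0 :=
    (map_ne_zero_iff _ (IsFractionRing.injective _ K)).2 hden
  have hmap := map_clearDenominators (IsScalarTower.toAlgHom k _ K) hden' num R
  rw [← map_eq_zero_iff _ (IsFractionRing.injective (MvPolynomial σ k) K),
    ← IsScalarTower.coe_toAlgHom' k, hmap, mul_eq_zero]
  exact (or_iff_right (pow_ne_zero _ hden')).symm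

theorem eval_graph_eq_zero
    (hR : aeval (Sum.elim (genericPoint k K)
      fun j => algebraMap _ K (num j) / algebraMap _ K den) R = 0)
    {v : σ → k} (hv : eval v den ≠ 0) :
    eval (Sum.elim v fun j => eval v (num j) / eval v den) R = 0 := by
  have hmap := map_clearDenominators (aeval v) hv num R
  rw [(aeval_graph_eq_zero_iff_clearDenominators hden).1 hR, map_zero, zero_eq_mul] at hmap
  simpa [aeval_eq_eval] using hmap.resolve_left (pow_ne_zero _ hv)

theorem exists_forall_eval_graph_ne_zero
    (hR : aeval (Sum.elim (genericPoint k K)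
      fun j => algebraMap _ K (num j) / algebraMap _ K den) R ≠ 0) :
    ∃ P : MvPolynomial σ k, P ≠ 0 ∧ ∀ v, eval v P ≠ 0 → eval v den ≠ 0 ∧
      eval (Sum.elim v fun j => eval v (num j) / eval v den) R ≠ 0 := by
  rw [Ne, aeval_graph_eq_zero_iff_clearDenominators hden] at hR
  refine ⟨den * clearDenominators den num R, mul_ne_zero hden hR, fun v hv => ?_⟩
  rw [map_mul] at hv
  have hdv := left_ne_zero_of_mul hv
  have hmap := map_clearDenominators (aeval v) hdv num R
  simp only [aeval_eq_eval, aeval_X] at hmap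
  exact ⟨hdv, right_ne_zero_of_mul (hmap ▸ right_ne_zero_of_mul hv)⟩

theorem aeval_graph_eq_zero [Infinite k] {P : MvPolynomial σ k} (hP : P ≠ 0)
    (hR : ∀ v, eval v P ≠ 0 → eval v den ≠ 0 →
      eval (Sum.elim v fun j => eval v (num j) / eval v den) R = 0) :
    aeval (Sum.elim (genericPoint k K)
      fun j => algebraMap _ K (num j) / algebraMap _ K den) R = 0 := by
  by_contra h
  obtain ⟨P', hP', h⟩ := exists_forall_eval_graph_ne_zero hden h
  refine mul_ne_zero hP hP' (funext fun v => ?_)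
  by_contra hv
  rw [map_zero, map_mul] at hv
  obtain ⟨hd, hne⟩ := h v (right_ne_zero_of_mul hv)
  exact hne (hR v (left_ne_zero_of_mul hv) hd)

end Specialization

/-! ### Rational maps -/

section GenericallyOnProj

theorem exists_eval_rep_ne_zero {k d : ℕ} [NeZero k] {P : MvPolynomial (Fin k) ℂ}
    (hP : P.IsHomogeneous d) (h0 : P ≠ 0) : ∃ u : ℙ ℂ (Fin k → ℂ), eval u.rep P ≠ 0 := by
  obtain ⟨v, hv⟩ : ∃ v, eval v (P * X 0) ≠ 0 := by
    by_contra! h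
    exact mul_ne_zero h0 (X_ne_zero 0) (funext fun v => by rw [h v, map_zero])
  rw [map_mul, eval_X] at hv
  have hv0 : v ≠ 0 := fun h => right_ne_zero_of_mul hv (by rw [h]; rfl)
  obtain ⟨a, ha⟩ := Projectivization.exists_smul_eq_mk_rep ℂ v hv0
  refine ⟨Projectivization.mk ℂ v hv0, ?_⟩
  rw [← ha, Units.smul_def, eval_smul_of_isHomogeneous hP]
  exact mul_ne_zero (pow_ne_zero _ a.ne_zero) (left_ne_zero_of_mul hv)

theorem exists_eval_smul_ne_zero {k d : ℕ} {P : MvPolynomial (Fin k) ℂ} {v : Fin k → ℂ}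
    (hv : eval v (homogeneousComponent d P) ≠ 0) : ∃ t : ℂˣ, eval (t • v) P ≠ 0 := by
  let q : Polynomial ℂ := ∑ i ∈ Finset.range (P.totalDegree + 1),
    Polynomial.monomial i (eval v (homogeneousComponent i P))
  have hq (t : ℂ) : q.eval t = eval (t • v) P := by
    conv_rhs => rw [← sum_homogeneousComponent P]
    simp only [q, Polynomial.eval_finsetSum, Polynomial.eval_monomial, map_sum,
      eval_smul_of_isHomogeneous (homogeneousComponent_isHomogeneous _ P), mul_comm]
  have hq0 : q * Polynomial.X ≠ 0 := by
    refine mul_ne_zero (fun h => hv ?_) Polynomial.X_ne_zero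
    have hd : d < P.totalDegree + 1 := by
      by_contra! hd
      exact hv (by rw [homogeneousComponent_eq_zero _ _ (by omega), map_zero])
    simpa [q, Polynomial.finsetSum_coeff, Polynomial.coeff_monomial, hd] using
      congrArg (Polynomial.coeff · d) h
  obtain ⟨t, ht⟩ : ∃ t, (q * Polynomial.X).eval t ≠ 0 := by
    by_contra! h
    exact hq0 (Polynomial.funext fun t => by rw [h t, Polynomial.eval_zero])
  rw [Polynomial.eval_mul, Polynomial.eval_X, hq] at ht
  exact ⟨Units.mk0 t (right_ne_zero_of_mul ht), left_ne_zero_of_mul ht⟩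

theorem genericallyOnProj_iff {k : ℕ} [NeZero k] {p : ℙ ℂ (Fin k → ℂ) → Prop} :
    GenericallyOnProj p ↔ ∃ P : MvPolynomial (Fin k) ℂ, P ≠ 0 ∧
      ∀ (v : Fin k → ℂ) (hv : v ≠ 0), eval v P ≠ 0 → p (.mk ℂ v hv) := by
  constructor
  · rintro ⟨d, P, hP, ⟨u, hu⟩, hp⟩
    refine ⟨P, fun h => hu (by rw [h, map_zero]), fun v hv hPv => hp _ ?_⟩
    obtain ⟨a, ha⟩ := Projectivization.exists_smul_eq_mk_rep ℂ v hv
    rw [← ha, Units.smul_def, eval_smul_of_isHomogeneous hP]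
    exact mul_ne_zero (pow_ne_zero _ a.ne_zero) hPv
  · rintro ⟨P, hP, hp⟩
    obtain ⟨d, hd⟩ : ∃ d, homogeneousComponent d P ≠ 0 := by
      by_contra! h
      exact hP (by rw [← sum_homogeneousComponent P, Finset.sum_eq_zero fun i _ => h i])
    have hhom := homogeneousComponent_isHomogeneous d P
    refine ⟨d, _, hhom, exists_eval_rep_ne_zero hhom hd, fun u hu => ?_⟩
    obtain ⟨t, ht⟩ := exists_eval_smul_ne_zero hu
    have htu : t • u.rep ≠ 0 := (smul_ne_zero_iff_ne t).2 u.rep_nonzero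
    have hmk : Projectivization.mk ℂ (t • u.rep) htu = u := by
      conv_rhs => rw [← u.mk_rep]
      exact (Projectivization.mk_eq_mk_iff ℂ _ _ htu u.rep_nonzero).2 ⟨t, rfl⟩
    exact hmk ▸ hp _ htu ht

end GenericallyOnProj

section RationalMaps

variable {k m : ℕ}

namespace ProjToAff

/-- The values `(f_1(v) / f_0(v), …, f_m(v) / f_0(v))` of a rational map at homogeneous
coordinates. -/
def valueAt (φ : ProjToAff k m) (v : Fin k → ℂ) : Fin m → ℂ :=
  fun j => eval v (φ.num j) / eval v φ.den

/-- The set of values of a rational map. -/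
def image (φ : ProjToAff k m) : Set (Fin m → ℂ) := {y | ∃ u, φ.DefinedAt u ∧ φ.value u = y}

theorem image_subset_zariskiClosure (φ : ProjToAff k m) : φ.image ⊆ zariskiClosure φ.image :=
  zeroLocus_vanishingIdeal_le _

/-- The generic value `(f_1 / f_0, …, f_m / f_0)` of a rational map, in the field of rational
functions. -/
def generic (K : Type*) [Field K] [Algebra (MvPolynomial (Fin k) ℂ) K] (φ : ProjToAff k m) :
    Fin m → K := fun j => algebraMap _ K (φ.num j) / algebraMap _ K φ.den

end ProjToAff

variable (K : Type*) [Field K] [Algebra (MvPolynomial (Fin k) ℂ) K] [Algebra ℂ K]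
  {φ : ProjToAff k m} {γ : AffToProj m k} {S : Set (Fin m → ℂ)}

/-- `γ ∘ φ` is the identity at the generic point: the homogeneous coordinates of `γ` at the generic
value of `φ` are proportional to the variables. -/
def IsGenericLeftInverse (γ : AffToProj m k) (φ : ProjToAff k m) : Prop :=
  ∃ c : K, c ≠ 0 ∧ ∀ i, aeval (φ.generic K) (γ.coord i) = c * genericPoint ℂ K i

variable {K} [IsScalarTower ℂ (MvPolynomial (Fin k) ℂ) K]

theorem IsGenericLeftInverse.aeval_bind₁ {c : K}
    (hc : ∀ i, aeval (φ.generic K) (γ.coord i) = c * genericPoint ℂ K i) {d : ℕ}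
    {P : MvPolynomial (Fin k) ℂ} (hP : P.IsHomogeneous d) :
    aeval (φ.generic K) (bind₁ γ.coord P) = c ^ d * algebraMap _ K P := by
  rw [MvPolynomial.aeval_bind₁, _root_.funext hc, ← aeval_genericPoint (K := K) P]
  simp only [aeval_def, eval₂_eq, Finset.mul_sum]
  refine Finset.sum_congr rfl fun s hs => ?_
  simp only [mul_pow, Finset.prod_mul_distrib, Finset.prod_pow_eq_pow_sum]
  rw [← hP.degree_eq_sum_deg_support hs]
  ring

theorem AffToProj.eval_bind₁ (γ : AffToProj m k) (y : Fin m → ℂ) (P : MvPolynomial (Fin k) ℂ) :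
    eval y (bind₁ γ.coord P) = eval (γ.vec y) P := by
  rw [← aeval_eq_eval, MvPolynomial.aeval_bind₁, aeval_eq_eval]
  rfl

variable [IsFractionRing (MvPolynomial (Fin k) ℂ) K]

namespace ProjToAff

theorem eval_valueAt_eq_zero {Q : MvPolynomial (Fin m) ℂ}
    (hQ : aeval (φ.generic K) Q = 0) {v : Fin k → ℂ} (hv : eval v φ.den ≠ 0) :
    eval (φ.valueAt v) Q = 0 := by
  have hgraph : aeval (Sum.elim (genericPoint (σ := Fin k) ℂ K) (φ.generic K))
      (rename Sum.inr Q) = 0 := by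
    rwa [aeval_rename, Sum.elim_comp_inr]
  have hvalue := eval_graph_eq_zero φ.den_ne_zero hgraph hv
  rw [eval_rename, Sum.elim_comp_inr] at hvalue
  exact hvalue

theorem exists_forall_eval_valueAt_ne_zero {Q : MvPolynomial (Fin m) ℂ}
    (hQ : aeval (φ.generic K) Q ≠ 0) : ∃ P : MvPolynomial (Fin k) ℂ, P ≠ 0 ∧
      ∀ v, eval v P ≠ 0 → eval v φ.den ≠ 0 ∧ eval (φ.valueAt v) Q ≠ 0 := by
  have hgraph : aeval (Sum.elim (genericPoint (σ := Fin k) ℂ K) (φ.generic K))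
      (rename Sum.inr Q) ≠ 0 := by
    rwa [aeval_rename, Sum.elim_comp_inr]
  have hvalue := exists_forall_eval_graph_ne_zero φ.den_ne_zero hgraph
  simp only [eval_rename, Sum.elim_comp_inr] at hvalue
  exact hvalue

theorem aeval_generic_eq_zero {Q : MvPolynomial (Fin m) ℂ} {P : MvPolynomial (Fin k) ℂ}
    (hP : P ≠ 0) (hQ : ∀ v, eval v P ≠ 0 → eval v φ.den ≠ 0 → eval (φ.valueAt v) Q = 0) :
    aeval (φ.generic K) Q = 0 := by
  have hgraph : aeval (Sum.elim (genericPoint ℂ K) (φ.generic K)) (rename Sum.inr Q) = 0 :=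
    aeval_graph_eq_zero φ.den_ne_zero hP fun v hPv hv => by
      rw [eval_rename, Sum.elim_comp_inr]
      exact hQ v hPv hv
  rwa [aeval_rename, Sum.elim_comp_inr] at hgraph

section ZariskiClosure

variable [NeZero k]

theorem mem_vanishingIdeal_image_iff {Q : MvPolynomial (Fin m) ℂ} :
    Q ∈ vanishingIdeal ℂ φ.image ↔ aeval (φ.generic K) Q = 0 := by
  simp only [mem_vanishingIdeal_iff, aeval_eq_eval]
  refine ⟨fun hQ => ?_, ?_⟩
  · refine φ.aeval_generic_eq_zero (P := X (0 : Fin k)) (X_ne_zero 0) fun v hv0 hv => hQ _ ?_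
    have hne : v ≠ 0 := by rintro rfl; simp at hv0
    exact ⟨.mk ℂ v hne, (φ.definedAt_mk v hne).2 hv, φ.value_mk v hne⟩
  · rintro hQ _ ⟨u, hu, rfl⟩
    exact φ.eval_valueAt_eq_zero hQ hu

theorem vanishingIdeal_image :
    vanishingIdeal ℂ φ.image = RingHom.ker (aeval (φ.generic K) : _ →ₐ[ℂ] K) :=
  Ideal.ext fun _ => φ.mem_vanishingIdeal_image_iff

theorem eval_eq_zero_of_mem_zariskiClosure_image {y : Fin m → ℂ}
    (hy : y ∈ zariskiClosure φ.image) {Q : MvPolynomial (Fin m) ℂ}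
    (hQ : aeval (φ.generic K) Q = 0) : eval y Q = 0 := by
  simpa only [aeval_eq_eval] using
    mem_zeroLocus_iff.1 hy Q ((φ.mem_vanishingIdeal_image_iff (K := K)).2 hQ)

theorem exists_mem_zariskiClosure_image {Q : MvPolynomial (Fin m) ℂ}
    (hQ : aeval (φ.generic K) Q ≠ 0) : ∃ y ∈ zariskiClosure φ.image, eval y Q ≠ 0 := by
  contrapose! hQ
  refine (φ.mem_vanishingIdeal_image_iff (K := K)).1 fun y hy => ?_
  rw [aeval_eq_eval]
  exact hQ y (φ.image_subset_zariskiClosure hy)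

theorem zariskiClosure_image_eq_of_generic_eq {φ' : ProjToAff k m}
    (h : φ.generic K = φ'.generic K) : zariskiClosure φ.image = zariskiClosure φ'.image := by
  rw [zariskiClosure, zariskiClosure, φ.vanishingIdeal_image (K := K),
    φ'.vanishingIdeal_image (K := K), h]

end ZariskiClosure

end ProjToAff

theorem mk_eq_mk_of_mul_eq_mul {ι F : Type*} [Field F] {v w : ι → F} (hv : v ≠ 0) (hw : w ≠ 0)
    (h : ∀ i j, v i * w j = v j * w i) :
    Projectivization.mk F v hv = Projectivization.mk F w hw := by
  obtain ⟨i, hi⟩ := Function.ne_iff.1 hw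
  rw [Projectivization.mk_eq_mk_iff']
  refine ⟨v i / w i, _root_.funext fun j => ?_⟩
  have hi : w i ≠ 0 := hi
  simp only [Pi.smul_apply, smul_eq_mul]
  field_simp
  rw [h i j, mul_comm]

theorem IsGenericLeftInverse.value_eq (h : IsGenericLeftInverse K γ φ) {v : Fin k → ℂ}
    (hv : v ≠ 0) (hd : eval v φ.den ≠ 0) (hy : γ.vec (φ.valueAt v) ≠ 0) :
    γ.value (φ.valueAt v) hy = .mk ℂ v hv := by
  obtain ⟨c, -, hc⟩ := h
  refine mk_eq_mk_of_mul_eq_mul hy hv fun i j => ?_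
  have hgeneric : aeval (Sum.elim (genericPoint ℂ K) (φ.generic K))
      (rename Sum.inr (γ.coord i) * X (Sum.inl j) - rename Sum.inr (γ.coord j) * X (Sum.inl i)) =
        0 := by
    simp only [map_sub, map_mul, aeval_rename, Sum.elim_comp_inr, aeval_X, Sum.elim_inl, hc]
    ring
  have hvalue : eval (Sum.elim v (φ.valueAt v)) _ = 0 :=
    eval_graph_eq_zero φ.den_ne_zero hgeneric hd
  simp only [map_sub, map_mul, eval_rename, Sum.elim_comp_inr, eval_X, Sum.elim_inl,
    sub_eq_zero] at hvalue
  exact hvalue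

variable [NeZero k]

theorem IsGenericLeftInverse.genericallyOn (h : IsGenericLeftInverse K γ φ) :
    GenericallyOn (zariskiClosure φ.image) fun y => ∃ hy : γ.vec y ≠ 0,
      φ.DefinedAt (γ.value y hy) ∧ φ.value (γ.value y hy) = y := by
  obtain ⟨c, hc0, hc⟩ := h
  have hX : genericPoint ℂ K (0 : Fin k) ≠ 0 := genericPoint_ne_zero 0
  have hden : algebraMap _ K φ.den ≠ 0 :=
    (map_ne_zero_iff _ (IsFractionRing.injective _ K)).2 φ.den_ne_zero
  refine ⟨γ.coord 0 * bind₁ γ.coord φ.den, ?_, fun y hy hP => ?_⟩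
  · refine φ.exists_mem_zariskiClosure_image (K := K) ?_
    rw [map_mul, hc, aeval_bind₁ hc φ.den_homogeneous]
    exact mul_ne_zero (mul_ne_zero hc0 hX) (mul_ne_zero (pow_ne_zero _ hc0) hden)
  rw [map_mul, γ.eval_bind₁] at hP
  have hv : γ.vec y ≠ 0 := fun h0 => left_ne_zero_of_mul hP (congrFun h0 0)
  have hd := right_ne_zero_of_mul hP
  refine ⟨hv, (φ.definedAt_mk _ hv).2 hd, (φ.value_mk _ hv).trans (_root_.funext fun j => ?_)⟩
  have hj := φ.eval_eq_zero_of_mem_zariskiClosure_image (K := K) hy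
    (Q := bind₁ γ.coord (φ.num j) - X j * bind₁ γ.coord φ.den) (by
      rw [map_sub, map_mul, aeval_bind₁ hc φ.den_homogeneous, aeval_bind₁ hc (φ.num_homogeneous j),
        aeval_X, ProjToAff.generic]
      field_simp
      ring)
  rw [map_sub, map_mul, γ.eval_bind₁, γ.eval_bind₁, eval_X] at hj
  rw [div_eq_iff hd, sub_eq_zero.1 hj]

theorem IsGenericLeftInverse.genericallyOnProj (h : IsGenericLeftInverse K γ φ) :
    GenericallyOnProj fun u => φ.DefinedAt u ∧ φ.value u ∈ zariskiClosure φ.image ∧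
      ∃ hu : γ.vec (φ.value u) ≠ 0, γ.value (φ.value u) hu = u := by
  obtain ⟨c, hc0, hc⟩ := id h
  have hX : genericPoint ℂ K (0 : Fin k) ≠ 0 := genericPoint_ne_zero 0
  obtain ⟨P, hP, hne⟩ := φ.exists_forall_eval_valueAt_ne_zero (K := K) (Q := γ.coord 0)
    (by rw [hc]; exact mul_ne_zero hc0 hX)
  refine genericallyOnProj_iff.2 ⟨P, hP, fun v hv hPv => ?_⟩
  obtain ⟨hd, hγ⟩ := hne v hPv
  have hvalue : φ.value (.mk ℂ v hv) = φ.valueAt v := φ.value_mk v hv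
  have hd' := (φ.definedAt_mk v hv).2 hd
  have hy : γ.vec (φ.valueAt v) ≠ 0 := fun h0 => hγ (congrFun h0 0)
  rw [hvalue]
  exact ⟨hd', φ.image_subset_zariskiClosure ⟨_, hd', hvalue⟩, hy, h.value_eq hv hd hy⟩

theorem IsGenericLeftInverse.mutuallyInverse (h : IsGenericLeftInverse K γ φ) :
    MutuallyInverse (zariskiClosure φ.image) γ φ :=
  ⟨h.genericallyOn, h.genericallyOnProj⟩

theorem IsGenericLeftInverse.hasDegree_one (h : IsGenericLeftInverse K γ φ) :
    φ.HasDegree 1 := by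
  obtain ⟨P, hP, hgen⟩ := h.genericallyOn
  refine ⟨P, hP, fun y hy hPy => ?_⟩
  obtain ⟨hv, hd, hval⟩ := hgen y hy hPy
  refine Set.encard_eq_one.2 ⟨γ.value y hv, Set.eq_singleton_iff_unique_mem.2 ⟨⟨hd, hval⟩, ?_⟩⟩
  rintro u ⟨hu, rfl⟩
  exact u.mk_rep.symm.trans (h.value_eq u.rep_nonzero hu hv).symm

theorem MutuallyInverse.exists_ne_zero_forall (h : MutuallyInverse S γ φ) :
    ∃ P : MvPolynomial (Fin k) ℂ, P ≠ 0 ∧ ∀ v, eval v P ≠ 0 → eval v φ.den ≠ 0 ∧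
      φ.valueAt v ∈ S ∧ γ.vec (φ.valueAt v) ≠ 0 ∧ ∀ i j,
        γ.vec (φ.valueAt v) i * v j = γ.vec (φ.valueAt v) j * v i := by
  obtain ⟨P, hP, h⟩ := genericallyOnProj_iff.1 h.2
  refine ⟨P * X 0, mul_ne_zero hP (X_ne_zero 0), fun v hPv => ?_⟩
  rw [map_mul, eval_X] at hPv
  have hv : v ≠ 0 := fun h0 => right_ne_zero_of_mul hPv (congrFun h0 0)
  have hvalue : φ.value (.mk ℂ v hv) = φ.valueAt v := φ.value_mk v hv
  have hmk := h v hv (left_ne_zero_of_mul hPv)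
  rw [hvalue] at hmk
  obtain ⟨hd, hS, hy, hval⟩ := hmk
  refine ⟨(φ.definedAt_mk v hv).1 hd, hS, hy, fun i j => ?_⟩
  obtain ⟨a, ha⟩ := (Projectivization.mk_eq_mk_iff' ℂ _ _ hy hv).1 hval
  simp only [← ha, Pi.smul_apply, smul_eq_mul]
  ring

theorem MutuallyInverse.isGenericLeftInverse (h : MutuallyInverse S γ φ) :
    IsGenericLeftInverse K γ φ := by
  obtain ⟨P, hP, h⟩ := h.exists_ne_zero_forall
  have hX : genericPoint ℂ K (0 : Fin k) ≠ 0 := genericPoint_ne_zero 0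
  have hparallel (i j : Fin k) : aeval (φ.generic K) (γ.coord i) * genericPoint ℂ K j =
      aeval (φ.generic K) (γ.coord j) * genericPoint ℂ K i := by
    have hgraph : aeval (Sum.elim (genericPoint ℂ K) (φ.generic K)) (rename Sum.inr (γ.coord i) *
        X (Sum.inl j) - rename Sum.inr (γ.coord j) * X (Sum.inl i)) = 0 :=
      aeval_graph_eq_zero φ.den_ne_zero hP fun v hPv _ => by
        simp only [map_sub, map_mul, eval_rename, Sum.elim_comp_inr, eval_X, Sum.elim_inl]
        exact sub_eq_zero.2 ((h v hPv).2.2.2 i j)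
    simpa only [map_sub, map_mul, aeval_rename, Sum.elim_comp_inr, aeval_X, Sum.elim_inl,
      sub_eq_zero] using hgraph
  refine ⟨aeval (φ.generic K) (γ.coord 0) / genericPoint ℂ K 0, div_ne_zero (fun h0 => ?_) hX,
    fun i => by rw [div_mul_eq_mul_div, ← hparallel, mul_div_cancel_right₀ _ hX]⟩
  obtain ⟨v, hv⟩ : ∃ v, eval v P ≠ 0 := by
    by_contra! h
    exact hP (funext fun v => by rw [h v, map_zero])
  obtain ⟨hd, -, hy, -⟩ := h v hv
  refine hy (_root_.funext fun i => φ.eval_valueAt_eq_zero (K := K) ?_ hd)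
  simpa [h0, hX] using hparallel i 0

theorem MutuallyInverse.mem_vanishingIdeal_iff (h : MutuallyInverse S γ φ)
    (hS : (vanishingIdeal ℂ S).IsPrime) {Q : MvPolynomial (Fin m) ℂ} :
    Q ∈ vanishingIdeal ℂ S ↔ aeval (φ.generic K) Q = 0 := by
  refine ⟨fun hQ => ?_, fun hQ => ?_⟩
  · obtain ⟨P, hP, hu⟩ := h.exists_ne_zero_forall
    refine φ.aeval_generic_eq_zero hP fun v hPv _ => ?_
    simpa only [aeval_eq_eval] using hQ _ (hu v hPv).2.1
  · obtain ⟨P, ⟨y, hyS, hyP⟩, hP⟩ := h.1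
    have hPQ : P * Q ∈ vanishingIdeal ℂ S := fun z hz => by
      rw [aeval_eq_eval, map_mul, mul_eq_zero, or_iff_not_imp_left]
      intro hPz
      obtain ⟨hv, hd, hval⟩ := hP z hz hPz
      rw [← hval]
      exact φ.eval_valueAt_eq_zero hQ hd
    refine (hS.mem_or_mem hPQ).resolve_left fun hPS => hyP ?_
    simpa only [aeval_eq_eval] using hPS y hyS

theorem MutuallyInverse.zariskiClosure_image (h : MutuallyInverse S γ φ)
    (hS : (vanishingIdeal ℂ S).IsPrime) : zariskiClosure φ.image = zariskiClosure S := by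
  let K := FractionRing (MvPolynomial (Fin k) ℂ)
  have hideal : vanishingIdeal ℂ φ.image = vanishingIdeal ℂ S := Ideal.ext fun Q => by
    rw [φ.mem_vanishingIdeal_image_iff (K := K), h.mem_vanishingIdeal_iff (K := K) hS]
  rw [zariskiClosure, hideal, zariskiClosure]

end RationalMaps

/-! ### Hypersurfaces -/

section Hypersurfaces

variable {m : ℕ} {S : Set (Fin m → ℂ)} {Δ : MvPolynomial (Fin m) ℂ}

theorem vanishingIdeal_zariskiClosure (V : Set (Fin m → ℂ)) :
    vanishingIdeal ℂ (zariskiClosure V) = vanishingIdeal ℂ V :=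
  (vanishingIdeal_anti_mono (zeroLocus_vanishingIdeal_le V)).antisymm
    (le_vanishingIdeal_zeroLocus _)

theorem zeroLocus_span_singleton {σ k : Type*} [Field k] (p : MvPolynomial σ k) :
    zeroLocus k (Ideal.span {p}) = {y | eval y p = 0} := by
  ext y
  simp [zeroLocus_span, aeval_eq_eval]

theorem IsMinimalEquation.isPrime_span (h : IsMinimalEquation Δ S) : (Ideal.span {Δ}).IsPrime :=
  (Ideal.span_singleton_prime h.irreducible.ne_zero).2 h.irreducible.prime

theorem IsMinimalEquation.vanishingIdeal_eq (h : IsMinimalEquation Δ S) :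
    vanishingIdeal ℂ S = Ideal.span {Δ} := by
  rw [h.zeroSet, ← zeroLocus_span_singleton, vanishingIdeal_zeroLocus_eq_radical,
    h.isPrime_span.radical]

theorem IsMinimalEquation.zariskiClosure_eq (h : IsMinimalEquation Δ S) : zariskiClosure S = S := by
  rw [zariskiClosure, h.vanishingIdeal_eq, zeroLocus_span_singleton, h.zeroSet]

theorem IsMinimalEquation.codim_le_one (h : IsMinimalEquation Δ S) : codim S ≤ 1 := by
  have := h.isPrime_span
  rw [codim, h.vanishingIdeal_eq]
  exact Ideal.height_le_one_of_isPrincipal_of_mem_minimalPrimes (Ideal.span {Δ}) _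
    (by rw [Ideal.minimalPrimes_eq_subsingleton_self]; rfl)

theorem codim_zariskiClosure (V : Set (Fin m → ℂ)) : codim (zariskiClosure V) = codim V := by
  rw [codim, vanishingIdeal_zariskiClosure, codim]

theorem exists_isMinimalEquation_of_codim_eq_one {V : Set (Fin m → ℂ)}
    (hprime : (vanishingIdeal ℂ V).IsPrime) (hcodim : codim V = 1) :
    ∃ Δ, IsMinimalEquation Δ (zariskiClosure V) := by
  obtain ⟨Δ, hΔ⟩ := (UniqueFactorizationMonoid.isPrincipal_of_height_eq_one hcodim).principal
  replace hΔ : vanishingIdeal ℂ V = Ideal.span {Δ} := hΔ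
  have hΔ0 : Δ ≠ 0 := by
    rintro rfl
    rw [codim, hΔ, Ideal.span_singleton_zero, Ideal.height_bot] at hcodim
    exact zero_ne_one hcodim
  rw [hΔ, Ideal.span_singleton_prime hΔ0] at hprime
  exact ⟨Δ, hprime.irreducible, by rw [zariskiClosure, hΔ, zeroLocus_span_singleton]⟩

end Hypersurfaces

/-! ### Sections of the logarithmic Gauss map -/

theorem algebraicIndependent_subtype_ne_of_mem_vars {σ R A : Type*} [CommRing R] [IsDomain R]
    [CommRing A] [Algebra R A] {g : σ → A} {p : MvPolynomial σ R}
    (hker : ∀ q, aeval g q = 0 → p ∣ q) {i₀ : σ} (hi₀ : i₀ ∈ p.vars) :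
    AlgebraicIndependent R fun i : {i // i ≠ i₀} => g i := by
  rw [algebraicIndependent_iff]
  intro q hq
  obtain ⟨r, hr⟩ : p ∣ rename Subtype.val q := hker _ (by rw [aeval_rename]; exact hq)
  by_contra hq0
  have hne : p * r ≠ 0 := hr ▸ (map_ne_zero_iff _ (rename_injective _ Subtype.val_injective)).2 hq0
  have hdeg : degreeOf i₀ (rename (Subtype.val : {i // i ≠ i₀} → σ) q) = 0 := by
    classical
    by_contra hmem
    obtain ⟨i, -, hi⟩ := Finset.mem_image.1 (vars_rename _ q (mem_vars_iff_degreeOf_ne_zero.2 hmem))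
    exact i.2 hi
  rw [hr, degreeOf_mul_eq (left_ne_zero_of_mul hne) (right_ne_zero_of_mul hne)] at hdeg
  exact mem_vars_iff_degreeOf_ne_zero.1 hi₀ (Nat.eq_zero_of_add_eq_zero_right hdeg)

theorem linearIndependent_dlog_of_algebraicIndependent {ι k K : Type*} [Field k] [CharZero k]
    [Field K] [Algebra k K] {x : ι → K} (hx : AlgebraicIndependent k x) (h0 : ∀ i, x i ≠ 0) :
    LinearIndependent K fun i => dlog k (x i) :=
  (linearIndependent_D_of_algebraicIndependent hx).units_smul fun i => (Units.mk0 (x i) (h0 i))⁻¹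

theorem sum_aeval_smul_dlog {σ k K : Type*} [Fintype σ] [CommRing k] [Field K] [Algebra k K]
    {g : σ → K} (hg : ∀ i, g i ≠ 0) (p : MvPolynomial σ k) :
    ∑ i, aeval g (X i * pderiv i p) • dlog k (g i) = D k K (aeval g p) := by
  rw [derivation_aeval]
  refine Finset.sum_congr rfl fun i _ => ?_
  rw [map_mul, aeval_X, mul_comm, mul_smul, smul_dlog (hg i)]

section LogGauss

variable {m : ℕ} {K : Type*} [Field K] [Algebra (MvPolynomial (Fin m) ℂ) K]
  [IsFractionRing (MvPolynomial (Fin m) ℂ) K] [Algebra ℂ K]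
  {φ : ProjToAff m m} {Δ : MvPolynomial (Fin m) ℂ}

theorem IsLogGaussSection.isGenericLeftInverse
    (hg : IsLogGaussSection ℂ (genericPoint ℂ K) (φ.generic K)) (hΔ : Irreducible Δ)
    (hker : ∀ Q, aeval (φ.generic K) Q = 0 ↔ Δ ∣ Q) :
    IsGenericLeftInverse K (logGauss Δ) φ := by
  obtain ⟨i₀, hi₀⟩ := exists_pderiv_not_dvd hΔ.ne_zero hΔ.not_isUnit
  have hvars : i₀ ∈ Δ.vars := by
    by_contra h
    exact hi₀ (by rw [pderiv_eq_zero_of_notMem_vars h]; exact dvd_zero Δ)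
  have hindep : LinearIndependent K fun i : {i // i ≠ i₀} => dlog ℂ (φ.generic K i) :=
    linearIndependent_dlog_of_algebraicIndependent
      (algebraicIndependent_subtype_ne_of_mem_vars (fun Q => (hker Q).1) hvars)
      fun i => hg.ne_zero i
  have hsum : ∑ i, aeval (φ.generic K) ((logGauss Δ).coord i) • dlog ℂ (φ.generic K i) = 0 := by
    rw [logGauss, sum_aeval_smul_dlog hg.ne_zero, (hker Δ).2 dvd_rfl, map_zero]
  have hne : aeval (φ.generic K) ((logGauss Δ).coord i₀) ≠ 0 := by
    rw [logGauss, map_mul, aeval_X]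
    exact mul_ne_zero (hg.ne_zero i₀) (mt (hker _).1 hi₀)
  have hX : genericPoint ℂ K i₀ ≠ 0 := genericPoint_ne_zero i₀
  refine ⟨_, div_ne_zero hne hX, fun i => ?_⟩
  rw [div_mul_eq_mul_div, eq_div_iff hX]
  exact mul_eq_mul_of_sum_smul_eq_zero (v := fun i => dlog ℂ (φ.generic K i)) hindep hsum
    hg.sum_smul_dlog i

theorem IsGenericLeftInverse.isLogGaussSection (h : IsGenericLeftInverse K (logGauss Δ) φ)
    (hΔ : aeval (φ.generic K) Δ = 0) :
    IsLogGaussSection ℂ (genericPoint ℂ K) (φ.generic K) := by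
  obtain ⟨c, hc0, hc⟩ := h
  have hne (i : Fin m) : φ.generic K i ≠ 0 := fun h0 => by
    have hi := hc i
    rw [logGauss, map_mul, aeval_X, h0, zero_mul] at hi
    exact mul_ne_zero hc0 (genericPoint_ne_zero i) hi.symm
  refine ⟨hne, ?_⟩
  have hsum := sum_aeval_smul_dlog hne Δ
  rw [hΔ, map_zero] at hsum
  refine (smul_eq_zero_iff_right hc0).1 ?_
  rw [Finset.smul_sum, ← hsum]
  exact Finset.sum_congr rfl fun i _ => by rw [smul_smul, ← hc i, logGauss]

variable [NeZero m] [IsScalarTower ℂ (MvPolynomial (Fin m) ℂ) K]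

theorem IsLogGaussSection.isGenericLeftInverse_of_isMinimalEquation
    (hg : IsLogGaussSection ℂ (genericPoint ℂ K) (φ.generic K))
    (hΔ : IsMinimalEquation Δ (zariskiClosure φ.image)) :
    IsGenericLeftInverse K (logGauss Δ) φ :=
  hg.isGenericLeftInverse hΔ.irreducible fun Q => by
    rw [← φ.mem_vanishingIdeal_image_iff, ← vanishingIdeal_zariskiClosure, hΔ.vanishingIdeal_eq,
      Ideal.mem_span_singleton]

theorem IsLogGaussSection.codim_image_ne_zero
    (hg : IsLogGaussSection ℂ (genericPoint ℂ K) (φ.generic K)) : codim φ.image ≠ 0 := by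
  rw [codim, Ne, φ.vanishingIdeal_image (K := K), Ideal.height_eq_zero_iff_eq_bot]
  exact fun hbot => hg.not_algebraicIndependent genericPoint_ne_zero
    ((RingHom.injective_iff_ker_eq_bot _).2 hbot)

theorem IsLogGaussSection.exists_isMinimalEquation
    (hg : IsLogGaussSection ℂ (genericPoint ℂ K) (φ.generic K)) (hcodim : codim φ.image ≤ 1) :
    ∃ Δ, IsMinimalEquation Δ (zariskiClosure φ.image) :=
  exists_isMinimalEquation_of_codim_eq_one
    (φ.vanishingIdeal_image (K := K) ▸ RingHom.ker_isPrime _)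
    (hcodim.antisymm (Order.one_le_iff_ne_zero.2 hg.codim_image_ne_zero))

end LogGauss

/-! ### Torus translates and Horn–Kapranov parametrizations -/

section HornProduct

variable {ι κ σ F : Type*} [Fintype ι] [Fintype κ] [Fintype σ] [Field F] (u : σ → F)

theorem hornProduct_comp_equiv (C : ι → σ → ℤ) (e : κ ≃ ι) :
    hornProduct (C ∘ e) u = hornProduct C u :=
  _root_.funext fun j => e.prod_comp fun i => intForm u (C i) ^ C i j

theorem hornProduct_sumElim (C : ι → σ → ℤ) (C' : κ → σ → ℤ) :
    hornProduct (Sum.elim C C') u = hornProduct C u * hornProduct C' u :=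
  _root_.funext fun _ => Fintype.prod_sum_type _

theorem hornProduct_single [DecidableEq σ] (a : ℤ) :
    hornProduct (fun j : σ => Pi.single j a) u = fun j => (a • u j) ^ a := by
  ext k
  have hsingle (j : σ) : intForm u (Pi.single j a) = a • u j :=
    Fintype.linearCombination_apply_single ℤ u j a
  rw [hornProduct, Finset.prod_eq_single k]
  · rw [hsingle, Pi.single_eq_same]
  · intro j _ hj
    rw [Pi.single_eq_of_ne hj.symm, zpow_zero]
  · simp

end HornProduct

theorem rank_eq_card_of_forall_exists_row_eq_single {ι σ F : Type*} [Fintype σ] [DecidableEq σ]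
    [CommRing F] [Nontrivial F] {A : Matrix ι σ F} (hA : ∀ j, ∃ i, A i = Pi.single j 1) :
    A.rank = Fintype.card σ := by
  rw [Matrix.rank, LinearMap.finrank_range_of_inj, Module.finrank_fintype_fun_eq_card]
  rw [← LinearMap.ker_eq_bot, LinearMap.ker_eq_bot']
  intro w hw
  ext j
  obtain ⟨i, hi⟩ := hA j
  have hwi : A i ⬝ᵥ w = 0 := congrFun hw i
  rwa [hi, single_one_dotProduct] at hwi

theorem exists_isHornMatrix_hornProduct_eq_neg {ι F : Type*} [Fintype ι] [Field F] {m : ℕ}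
    {r : ι → Fin m → ℤ} (hr : ∀ i, r i ≠ 0) (hsum : ∑ i, r i = 0) {u : Fin m → F}
    (hu : ∀ j, u j ≠ 0) : ∃ (n : ℕ) (C : Matrix (Fin n) (Fin m) ℤ), IsHornMatrix C ∧
      hornProduct C u = -hornProduct r u := by
  let R : ι ⊕ (Fin m ⊕ Fin m) → Fin m → ℤ :=
    Sum.elim r (Sum.elim (fun j => Pi.single j 1) fun j => Pi.single j (-1))
  have hR0 : ∀ i, R i ≠ 0 := by
    rintro (i | j | j)
    exacts [hr i, by simp [R], by simp [R]]
  have hRsum : ∑ i, R i = 0 := by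
    simp [R, hsum, ← Finset.sum_add_distrib, ← Pi.single_add]
  have hRprod : hornProduct R u = -hornProduct r u := by
    ext k
    have := hu k
    simp only [R, hornProduct_sumElim, hornProduct_single, Pi.mul_apply, Pi.neg_apply, one_smul,
      zpow_one, neg_smul, zpow_neg]
    field_simp
  let e := (Fintype.equivFin (ι ⊕ (Fin m ⊕ Fin m))).symm
  refine ⟨_, Matrix.of (R ∘ e), ⟨fun k => ?_, fun i => hR0 (e i), ?_⟩,
    (hornProduct_comp_equiv u R e).trans hRprod⟩
  · have hk := congrFun hRsum k
    rw [← e.sum_comp, Finset.sum_apply] at hk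
    exact hk
  · rw [rank_eq_card_of_forall_exists_row_eq_single, Fintype.card_fin]
    refine fun j => ⟨e.symm (.inr (.inl j)), _root_.funext fun k => ?_⟩
    simp [R, Matrix.map_apply, Pi.single_apply]

theorem IsLogGaussSection.exists_isHornMatrix {m : ℕ} {K : Type*} [Field K]
    [Algebra (MvPolynomial (Fin m) ℂ) K] [IsFractionRing (MvPolynomial (Fin m) ℂ) K] [Algebra ℂ K]
    [IsScalarTower ℂ (MvPolynomial (Fin m) ℂ) K] {g : Fin m → K}
    (hg : IsLogGaussSection ℂ (genericPoint ℂ K) g) :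
    ∃ (n : ℕ) (C : Matrix (Fin n) (Fin m) ℤ) (τ : Fin m → ℂˣ), IsHornMatrix C ∧
      ∀ k, g k = algebraMap ℂ K (τ k) * hornProduct C (genericPoint ℂ K) k := by
  obtain ⟨_, r, t, hr, hsum, hgr⟩ := hg.exists_regular_eq_hornProduct
  obtain ⟨n, C, hC, hprod⟩ :=
    exists_isHornMatrix_hornProduct_eq_neg hr hsum (u := genericPoint ℂ K) genericPoint_ne_zero
  refine ⟨n, C, -t, hC, fun k => ?_⟩
  rw [hgr, hprod, Pi.neg_apply, Pi.neg_apply, Units.val_neg, map_neg, neg_mul_neg]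

section TorusTranslate

variable {k m : ℕ}

/-- The pull-back of polynomials along the torus translation by `τ`. -/
def scale (τ : Fin m → ℂˣ) : MvPolynomial (Fin m) ℂ ≃ₐ[ℂ] MvPolynomial (Fin m) ℂ :=
  AlgEquiv.ofAlgHom (aeval fun j => C (τ j : ℂ) * X j) (aeval fun j => C ((τ j)⁻¹ : ℂ) * X j)
    (by ext j; simp [← mul_assoc, ← C_mul]) (by ext j; simp [← mul_assoc, ← C_mul])

theorem eval_scale (τ : Fin m → ℂˣ) (y : Fin m → ℂ) (Q : MvPolynomial (Fin m) ℂ) :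
    eval y (scale τ Q) = eval (fun j => (τ j : ℂ) * y j) Q := by
  have hcomp : (aeval y).comp (scale τ : _ →ₐ[ℂ] _) = aeval fun j => (τ j : ℂ) * y j := by
    ext j
    simp [scale]
  rw [← aeval_eq_eval, ← aeval_eq_eval]
  exact DFunLike.congr_fun hcomp Q

theorem mem_vanishingIdeal_torusTranslate_iff (τ : Fin m → ℂˣ) (V : Set (Fin m → ℂ))
    {Q : MvPolynomial (Fin m) ℂ} :
    Q ∈ vanishingIdeal ℂ (torusTranslate τ V) ↔ scale τ Q ∈ vanishingIdeal ℂ V := by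
  simp only [mem_vanishingIdeal_iff, torusTranslate, Set.forall_mem_image, aeval_eq_eval,
    eval_scale]

theorem codim_torusTranslate (τ : Fin m → ℂˣ) (V : Set (Fin m → ℂ)) :
    codim (torusTranslate τ V) = codim V := by
  have hcomap : vanishingIdeal ℂ (torusTranslate τ V) =
      (vanishingIdeal ℂ V).comap (scale τ).toRingEquiv :=
    Ideal.ext fun _ => mem_vanishingIdeal_torusTranslate_iff τ V
  rw [codim, hcomap, RingEquiv.height_comap, codim]

theorem torusTranslate_zariskiClosure (τ : Fin m → ℂˣ) (V : Set (Fin m → ℂ)) :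
    torusTranslate τ (zariskiClosure V) = zariskiClosure (torusTranslate τ V) := by
  have hmem (y : Fin m → ℂ) : (fun j => (τ j : ℂ) * y j) ∈ zariskiClosure (torusTranslate τ V) ↔
      y ∈ zariskiClosure V := by
    simp only [zariskiClosure, mem_zeroLocus_iff, aeval_eq_eval,
      mem_vanishingIdeal_torusTranslate_iff, (scale τ).surjective.forall (p := fun Q =>
        Q ∈ vanishingIdeal ℂ V → eval y Q = 0), eval_scale]
  ext z
  refine ⟨by rintro ⟨y, hy, rfl⟩; exact (hmem y).2 hy, fun hz => ?_⟩
  have hz' : z = fun j => (τ j : ℂ) * ((τ j : ℂ)⁻¹ * z j) := by simp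
  rw [hz', hmem] at hz
  exact ⟨_, hz, hz'.symm⟩

theorem ProjToAff.translate_one (φ : ProjToAff k m) : φ.translate 1 = φ := by
  simp [ProjToAff.translate]

theorem ProjToAff.image_translate (τ : Fin m → ℂˣ) (φ : ProjToAff k m) :
    (φ.translate τ).image = torusTranslate τ φ.image := by
  have hvalue (u) : (φ.translate τ).value u = fun j => (τ j : ℂ) * φ.value u j := by
    ext j
    simp [ProjToAff.value, ProjToAff.translate, mul_div_assoc]
  ext y
  constructor
  · rintro ⟨u, hu, rfl⟩
    exact ⟨φ.value u, ⟨u, hu, rfl⟩, (hvalue u).symm⟩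
  · rintro ⟨_, ⟨u, hu, rfl⟩, rfl⟩
    exact ⟨u, hu, hvalue u⟩

end TorusTranslate

section Parametrization

variable {m n : ℕ} {C : Matrix (Fin n) (Fin m) ℤ} (hC : IsHornMatrix C) (τ : Fin m → ℂˣ)

section Generic

variable (K : Type*) [Field K] [Algebra (MvPolynomial (Fin m) ℂ) K]
  [IsFractionRing (MvPolynomial (Fin m) ℂ) K] [Algebra ℂ K]
  [IsScalarTower ℂ (MvPolynomial (Fin m) ℂ) K]

theorem linPoly_eq_intForm (i : Fin n) : linPoly C i = intForm X (C i) := by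
  simp [linPoly, intForm_apply]

theorem generic_translate_hornKapranov : ((hornKapranov C hC).translate τ).generic K = fun k =>
    algebraMap ℂ K (τ k) * hornProduct C (genericPoint ℂ K) k := by
  have hl (i : Fin n) : intForm (genericPoint ℂ K) (C i) ≠ 0 :=
    intForm_genericPoint_ne_zero (hC.row_ne_zero i)
  ext k
  simp only [ProjToAff.generic, ProjToAff.translate, hornKapranov, map_mul, map_prod, map_pow,
    linPoly_eq_intForm, algebraMap_intForm_X, hornProduct]
  rw [mul_div_assoc, ← Finset.prod_div_distrib, ← algebraMap_eq, ← IsScalarTower.algebraMap_apply]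
  congr 1
  refine Finset.prod_congr rfl fun i _ => ?_
  rw [← zpow_natCast, ← zpow_natCast, ← zpow_sub₀ (hl i), Int.toNat_of_nonneg (neg_le_denExp C i k),
    add_sub_cancel_right]

theorem isLogGaussSection_hornKapranov : IsLogGaussSection ℂ (genericPoint ℂ K)
    (((hornKapranov C hC).translate τ).generic K) := by
  rw [generic_translate_hornKapranov]
  refine isLogGaussSection_hornProduct
    (fun i => intForm_genericPoint_ne_zero (hC.row_ne_zero i)) (_root_.funext fun k => ?_) τ
  exact (Finset.sum_apply k _ _).trans (hC.regular k)

end Generic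

variable [NeZero m]

include hC in
theorem IsHornMatrix.zero_notMem_psiDomain : (0 : Fin m → ℂ) ∉ psiDomain C := by
  intro h
  have hnonneg (i k) : 0 ≤ C i k := by
    by_contra! hlt
    exact h i k hlt (by simp [linForm])
  have h0 : C = 0 := Matrix.ext fun i k =>
    (Finset.sum_eq_zero_iff_of_nonneg fun i _ => hnonneg i k).1 (hC.regular k) i (Finset.mem_univ i)
  have hrank := hC.full_rank
  rw [h0, Matrix.map_zero _ Int.cast_zero, Matrix.rank_zero] at hrank
  exact NeZero.ne m hrank.symm

theorem image_hornKapranov : (hornKapranov C hC).image = psi C '' psiDomain C := by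
  ext y
  constructor
  · rintro ⟨u, hu, rfl⟩
    rw [← u.mk_rep] at hu ⊢
    rw [hornKapranov_definedAt_mk] at hu
    exact ⟨_, hu, (hornKapranov_value_mk hC _ _ hu).symm⟩
  · rintro ⟨u, hu, rfl⟩
    have hu0 : u ≠ 0 := fun h => hC.zero_notMem_psiDomain (h ▸ hu)
    exact ⟨_, (hornKapranov_definedAt_mk hC u hu0).2 hu, hornKapranov_value_mk hC u hu0 hu⟩

theorem torusTranslate_SC :
    torusTranslate τ (SC C) = zariskiClosure ((hornKapranov C hC).translate τ).image := by
  rw [SC, torusTranslate_zariskiClosure, ← image_hornKapranov hC, ProjToAff.image_translate]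

theorem mutuallyInverse_logGauss_hornKapranov {Δ : MvPolynomial (Fin m) ℂ}
    (hΔ : IsMinimalEquation Δ (torusTranslate τ (SC C))) :
    MutuallyInverse (torusTranslate τ (SC C)) (logGauss Δ) ((hornKapranov C hC).translate τ) := by
  rw [torusTranslate_SC hC] at hΔ ⊢
  exact ((isLogGaussSection_hornKapranov hC τ (FractionRing (MvPolynomial (Fin m) ℂ))
    ).isGenericLeftInverse_of_isMinimalEquation hΔ).mutuallyInverse

theorem hasDegree_one_hornKapranov (hd : ¬ Defective C) : (hornKapranov C hC).HasDegree 1 := by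
  have hsection := isLogGaussSection_hornKapranov hC 1 (FractionRing (MvPolynomial (Fin m) ℂ))
  have hcodim : codim (SC C) ≤ 1 := not_lt.1 hd
  rw [SC, codim_zariskiClosure, ← image_hornKapranov hC] at hcodim
  rw [ProjToAff.translate_one] at hsection
  obtain ⟨Δ, hΔ⟩ := hsection.exists_isMinimalEquation hcodim
  exact (hsection.isGenericLeftInverse_of_isMinimalEquation hΔ).hasDegree_one

theorem exists_isHornMatrix_of_isBirationalOn_logGauss {S : Set (Fin m → ℂ)}
    {Δ : MvPolynomial (Fin m) ℂ} (hΔ : IsMinimalEquation Δ S) (h : (logGauss Δ).IsBirationalOn S) :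
    ∃ (n : ℕ) (C : Matrix (Fin n) (Fin m) ℤ) (τ : Fin m → ℂˣ),
      IsHornMatrix C ∧ ¬ Defective C ∧ S = torusTranslate τ (SC C) := by
  let K := FractionRing (MvPolynomial (Fin m) ℂ)
  obtain ⟨φ, hφ⟩ := h
  have hprime : (vanishingIdeal ℂ S).IsPrime := hΔ.vanishingIdeal_eq ▸ hΔ.isPrime_span
  have hmem : Δ ∈ vanishingIdeal ℂ S := hΔ.vanishingIdeal_eq ▸ Ideal.mem_span_singleton_self Δ
  have hsection : IsLogGaussSection ℂ (genericPoint ℂ K) (φ.generic K) :=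
    hφ.isGenericLeftInverse.isLogGaussSection ((hφ.mem_vanishingIdeal_iff hprime).1 hmem)
  obtain ⟨n, C, τ, hC, hgC⟩ := hsection.exists_isHornMatrix
  have hgeneric : φ.generic K = ((hornKapranov C hC).translate τ).generic K := by
    rw [generic_translate_hornKapranov]
    exact _root_.funext hgC
  have hS : S = torusTranslate τ (SC C) := by
    rw [torusTranslate_SC hC, ← ProjToAff.zariskiClosure_image_eq_of_generic_eq hgeneric,
      hφ.zariskiClosure_image hprime, hΔ.zariskiClosure_eq]
  refine ⟨n, C, τ, hC, ?_, hS⟩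
  rw [Defective, not_lt, ← codim_torusTranslate τ, ← hS]
  exact hΔ.codim_le_one

end Parametrization

end HornKapranov

end

open HornKapranov in
theorem mainTheorem1 (m : ℕ) (hm : 1 ≤ m) :
    (∀ (S : Set (Fin m → ℂ)) (Δ : MvPolynomial (Fin m) ℂ), IsMinimalEquation Δ S →
      ((logGauss Δ).IsBirationalOn S ↔
        ∃ (n : ℕ) (C : Matrix (Fin n) (Fin m) ℤ) (τ : Fin m → ℂˣ),
          IsHornMatrix C ∧ ¬ Defective C ∧ S = torusTranslate τ (SC C)) ∧
      (∀ (n : ℕ) (C : Matrix (Fin n) (Fin m) ℤ) (τ : Fin m → ℂˣ) (hC : IsHornMatrix C),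
        ¬ Defective C → S = torusTranslate τ (SC C) →
          ((hornKapranov C hC).translate τ).IsBirationalOnto S ∧
          MutuallyInverse S (logGauss Δ) ((hornKapranov C hC).translate τ))) ∧
    (∀ (n : ℕ) (C : Matrix (Fin n) (Fin m) ℤ) (hC : IsHornMatrix C),
      ¬ Defective C → (hornKapranov C hC).HasDegree 1) := by
  have : NeZero m := ⟨Nat.one_le_iff_ne_zero.1 hm⟩
  refine ⟨fun S Δ hΔ => ⟨⟨exists_isHornMatrix_of_isBirationalOn_logGauss hΔ, ?_⟩, ?_⟩,
    fun n C hC hd => hasDegree_one_hornKapranov hC hd⟩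
  · rintro ⟨n, C, τ, hC, -, rfl⟩
    exact ⟨_, mutuallyInverse_logGauss_hornKapranov hC τ hΔ⟩
  · rintro n C τ hC - rfl
    have h := mutuallyInverse_logGauss_hornKapranov hC τ hΔ
    exact ⟨⟨_, h⟩, h⟩
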